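/- Let \(n\ge 1\). Let \(W_n\) be the set of words in the letters \(\pm1,\dots,\pm n\) that use each absolute value exactly once (\(W_0\) consists of the empty word), with the right weak order, i.e. the partial order generated by the upward moves: swap adjacent letters \(\cdots ab\cdots\mapsto\cdots ba\cdots\) when \(a<b\) as integers, and flip the first letter \(a_1\mapsto -a_1\) when \(a_1>0\). Let \(\pi:W_n\to W_{n-1}\) be the deletion of the letter \(\pm n\). Write \(x\lessdot y\) for covers. A map \(\pi:P\to Q\) of posets is a *cylindrical projection* if (1) \(v\lessdot w\) implies \(\pi(v)=\pi(w)\) or \(\pi(v)\lessdot\pi(w)\); (2) every fibre is a chain with at least two elements; (3) every fibre has a minimum \(b(q)\) and a maximum \(t(q)\), and \(q\lessdot q'\iff b(q)\lessdot b(q')\iff t(q)\lessdot t(q')\). A cover \(v\lessdot w\) is *horizontal* if \(\pi(v)\lessdot\pi(w)\) and *vertical* if \(\pi(v)=\pi(w)\). The *augmented pre-Reeb graph* \(\widehat R(\pi)\) is the directed graph whose vertices are the classes \([v]\) of the equivalence relation on \(P\) generated by horizontal covers, with an edge \([v]\to[w]\) for every vertical cover \(v\lessdot w\) and for every incomparable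 pair \(v,w\in P\) with \(\pi(w)<\pi(v)\). For \(w\in W_n\) let \(\varepsilon\in\{+,-\}\) be the sign of the letter \(\pm n\) in \(w\), and let \(A\) be the set of signed letters to the right of \(\pm n\). The pair \((\varepsilon,A)\) depends only on the class \(x=[w]\). For \(1\le i<n\) put \[ (-n)(x)=\mathbf 1_{\varepsilon=-},\qquad (n,\pm i)(x)=\mathbf 1_{\pm i\in A}+\mathbf 1_{\varepsilon=-,\ i\notin A,\ -i\notin A}, \] \[ \nu(x)=\sum_{i=1}^{n-1}(n,-i)(x)\,2^{n-1-i}+(-n)(x)\,2^{n-1}+\sum_{i=1}^{n-1}(n,i)(x)\,2^{n-1+i}. \] A *cubic realization* of a poset \(P\) is an injective map \(c:P\to\mathbb R^d\) such that for every cover \(x\lessdot y\) the points \(c(x),c(y)\) differ in exactly one coordinate, which is larger for \(y\). It is *order-embedding* if \(x\le y\iff c(x)\le c(y)\) coordinatewise. A realization \(c_P:P\to\mathbb R^{d+1}\) is *compatible* with \(c_Q:Q\to\mathbb R^d\) and \(\pi:P\to Q\) if \(c_P(x)=(c_Q(\pi(x)),h(x))\) for some \(h:P\to\mathbb R\). Then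 the following hold. 1. The map \(\pi:W_n\to W_{n-1}\) is a cylindrical projection. 2. For every \(w\in W_n\), the bits \((n,i)([w]),(-n)([w]),(n,-i)([w])\) assemble to the same binary number \(\nu([w])\) as the indicators of the \(n\)-inversions of \(w\). Here \((-n)\) is an inversion of \(w\) iff the letter \(-n\) occurs in \(w\). For \(\delta=\pm1\), the symbol \((n,\delta i)\) is an inversion of \(w\) iff \(n\) or \(-n\) occurs to the left of \(\delta i\), or \(i\) or \(-i\) occurs to the left of \(-n\). 3. The graph \(\widehat R(\pi)\) is acyclic, and its reachability poset (\(x\le y\) iff there is a directed path, possibly of length \(0\), from \(x\) to \(y\)) is the total order induced by \(\nu\): \[ x\le y\iff \nu(x)\le\nu(y). \] 4. The graph \(\widehat R(\pi)\) has exactly \(2\cdot 3^{\,n-1}\) vertices. 5. Let \(c_Q:W_{n-1}\to\mathbb R^d\) be an order-embedding cubic realization. The order-embedding cubic realizations \(c_P:W_n\to\mathbb R^{d+1}\) compatible with \(c_Q\) and \(\pi\) are exactly the maps \(w\mapsto(c_Q(\pi(w)),h([w]))\), where \(h\) is a real function on the vertices of \(\widehat R(\pi)\) such that \(\nu(x)<\nu(y)\)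 implies \(h(x)<h(y)\). 6. There are order-embedding cubic realizations \(c_k:W_k\to\mathbb R^k\), \(0\le k\le n\), each compatible with the previous one under deletion. For any two such families \((c_k)\), \((c'_k)\), all \(x,y\in W_n\) and all \(1\le i\le n\), \[ c_n(x)_i\le c_n(y)_i\iff c'_n(x)_i\le c'_n(y)_i . \] -/

import Mathlib

open Relation

/-! ## Cubic realizations and (augmented) pre-Reeb graphs -/

/-- A cubic realization of a poset: an injective map to `ℝ^d` such that along every cover exactly
one coordinate changes, and that coordinate increases. -/
def IsCubicRealization {P : Type*} [PartialOrder P] {d : ℕ} (c : P → Fin d → ℝ) : Prop :=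
  Function.Injective c ∧
    ∀ x y : P, x ⋖ y → ∃ i, c x i < c y i ∧ ∀ j, j ≠ i → c x j = c y j

/-- An order-embedding cubic realization: moreover `x ≤ y` iff `c x ≤ c y` coordinatewise. -/
def IsOrderEmbeddingCubicRealization {P : Type*} [PartialOrder P] {d : ℕ}
    (c : P → Fin d → ℝ) : Prop :=
  IsCubicRealization c ∧ ∀ x y : P, x ≤ y ↔ ∀ i, c x i ≤ c y i

/-- `cP` is compatible with `cQ` and `π`: it has the form `x ↦ (cQ (π x), h x)`. -/
def IsCompatibleLift {P Q : Type*} (π : P → Q) {d : ℕ} (cQ : Q → Fin d → ℝ)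
    (cP : P → Fin (d + 1) → ℝ) : Prop :=
  ∃ h : P → ℝ, ∀ x, cP x = Fin.snoc (cQ (π x)) (h x)

/-- Cylindrical projections of posets. The maps `b` and `t` are the bottom and top sections. -/
def IsCylindricalProjection {P Q : Type*} [PartialOrder P] [PartialOrder Q] (π : P → Q) : Prop :=
  (∀ v w : P, v ⋖ w → π v = π w ∨ π v ⋖ π w) ∧
  (∀ q : Q, IsChain (· ≤ ·) (π ⁻¹' {q}) ∧ (π ⁻¹' {q}).Nontrivial) ∧
  ∃ b t : Q → P, (∀ q, IsLeast (π ⁻¹' {q}) (b q)) ∧ (∀ q, IsGreatest (π ⁻¹' {q}) (t q)) ∧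
    ∀ q q' : Q, (b q ⋖ b q' ↔ q ⋖ q') ∧ (t q ⋖ t q' ↔ q ⋖ q')

/-- Horizontal covers. -/
def HorizontalCover {P Q : Type*} [PartialOrder P] [PartialOrder Q] (π : P → Q) (v w : P) : Prop :=
  v ⋖ w ∧ π v ⋖ π w

/-- Vertical covers. -/
def VerticalCover {P Q : Type*} [PartialOrder P] (π : P → Q) (v w : P) : Prop :=
  v ⋖ w ∧ π v = π w

/-- The equivalence relation generated by horizontal covers. -/
def horizontalSetoid {P Q : Type*} [PartialOrder P] [PartialOrder Q] (π : P → Q) : Setoid P :=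
  EqvGen.setoid (HorizontalCover π)

/-- The horizontal classes, which are the vertices of the pre-Reeb graphs. -/
abbrev HorizontalClass {P Q : Type*} [PartialOrder P] [PartialOrder Q] (π : P → Q) : Type _ :=
  Quotient (horizontalSetoid π)

/-- The horizontal class `[v]`. -/
def horizontalClass {P Q : Type*} [PartialOrder P] [PartialOrder Q] (π : P → Q) (v : P) :
    HorizontalClass π :=
  Quotient.mk (horizontalSetoid π) v

/-- The pre-Reeb graph `R(π)`: edges come from vertical covers. -/
def preReebGraph {P Q : Type*} [PartialOrder P] [PartialOrder Q] (π : P → Q) :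
    Digraph (HorizontalClass π) where
  Adj x y := ∃ v w : P, horizontalClass π v = x ∧ horizontalClass π w = y ∧ VerticalCover π v w

/-- The auxiliary edges: `[v] → [w]` if `π w < π v` and `v`, `w` are incomparable. -/
def auxiliaryGraph {P Q : Type*} [PartialOrder P] [PartialOrder Q] (π : P → Q) :
    Digraph (HorizontalClass π) where
  Adj x y := ∃ v w : P, horizontalClass π v = x ∧ horizontalClass π w = y ∧
    π w < π v ∧ ¬ v ≤ w ∧ ¬ w ≤ v

/-- The augmented pre-Reeb graph: all edges of the pre-Reeb graph and all auxiliary edges. -/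
def augmentedPreReebGraph {P Q : Type*} [PartialOrder P] [PartialOrder Q] (π : P → Q) :
    Digraph (HorizontalClass π) :=
  preReebGraph π ⊔ auxiliaryGraph π

/-- A directed graph is acyclic if it has no directed cycle (a loop is a cycle). -/
def IsAcyclicDigraph {V : Type*} (G : Digraph V) : Prop :=
  ∀ x : V, ¬ TransGen G.Adj x x

/-- The reachability poset of an acyclic directed graph: `x ≤ y` iff there is a directed path
(possibly of length zero) from `x` to `y`. -/
def reachabilityPoset {V : Type*} (G : Digraph V) (hG : IsAcyclicDigraph G) : PartialOrder V where
  le x y := ReflTransGen G.Adj x y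
  le_refl _ := ReflTransGen.refl
  le_trans _ _ _ h₁ h₂ := h₁.trans h₂
  le_antisymm x y h₁ h₂ := by
    rcases reflTransGen_iff_eq_or_transGen.1 h₁ with h | h
    · exact h.symm
    · exact absurd (h.trans_left h₂) (hG x)

/-! ## Type B: signed words, weak order, deletion -/

/-- The hyperoctahedral group `W_n`, as the words in `±1, …, ±n` that use each absolute value
exactly once. -/
def SignedWord (n : ℕ) : Type :=
  {w : List ℤ // (w.map Int.natAbs).Perm (List.range' 1 n)}

/-- The upward moves of the right weak order of type B: swap adjacent letters `a b ↦ b a` with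
`a < b`, or flip the sign of a positive first letter. -/
def WeakMove (u v : List ℤ) : Prop :=
  (∃ (l : List ℤ) (a b : ℤ) (r : List ℤ), a < b ∧ u = l ++ a :: b :: r ∧ v = l ++ b :: a :: r) ∨
  (∃ (a : ℤ) (r : List ℤ), 0 < a ∧ u = a :: r ∧ v = (-a) :: r)

/-- The weighted sum `k a₁ + (k + 1) a₂ + …` of the letters (used only for antisymmetry). -/
def wordPotential : ℤ → List ℤ → ℤ
  | _, [] => 0
  | k, a :: l => k * a + wordPotential (k + 1) l

theorem wordPotential_swap (l : List ℤ) (a b : ℤ) (r : List ℤ) (hab : a < b) (k : ℤ) :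
    wordPotential k (l ++ b :: a :: r) < wordPotential k (l ++ a :: b :: r) := by
  induction l generalizing k with
  | nil => simp only [List.nil_append, wordPotential]; nlinarith
  | cons x l ih => simpa [wordPotential] using ih (k + 1)

theorem WeakMove.potential_lt {u v : List ℤ} (h : WeakMove u v) :
    wordPotential 1 v < wordPotential 1 u := by
  rcases h with ⟨l, a, b, r, hab, rfl, rfl⟩ | ⟨a, r, ha, rfl, rfl⟩
  · exact wordPotential_swap l a b r hab 1
  · simp only [wordPotential]; linarith

theorem weakMove_potential_le {n : ℕ} {u v : SignedWord n}
    (h : ReflTransGen (fun x y : SignedWord n => WeakMove x.1 y.1) u v) :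
    u = v ∨ wordPotential 1 v.1 < wordPotential 1 u.1 := by
  induction h with
  | refl => exact Or.inl rfl
  | tail _ hm ih =>
    rcases ih with rfl | ih
    · exact Or.inr hm.potential_lt
    · exact Or.inr (hm.potential_lt.trans ih)

/-- The right weak order on `W_n`, generated by the upward moves. -/
instance instPartialOrderSignedWord (n : ℕ) : PartialOrder (SignedWord n) where
  le u v := ReflTransGen (fun x y : SignedWord n => WeakMove x.1 y.1) u v
  le_refl _ := ReflTransGen.refl
  le_trans _ _ _ h₁ h₂ := h₁.trans h₂
  le_antisymm u v h₁ h₂ := by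
    rcases weakMove_potential_le h₁ with h | h
    · exact h
    · rcases weakMove_potential_le h₂ with h' | h'
      · exact h'.symm
      · exact absurd h (lt_asymm h')

/-- The deletion map `W_{n+1} → W_n`, erasing the letter `±(n+1)`. -/
def deletion (n : ℕ) (w : SignedWord (n + 1)) : SignedWord n :=
  ⟨w.1.filter (fun a => a.natAbs ≠ n + 1), by
    have h := w.2.filter (fun k => decide (k ≠ n + 1))
    rw [List.filter_map] at h
    refine h.trans (List.Perm.of_eq ?_)
    rw [List.range'_1_concat, List.filter_append, List.filter_eq_self.2]
    · simp [Nat.add_comm]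
    · intro a ha
      rw [List.mem_range'_1] at ha
      simp only [decide_eq_true_eq]
      omega⟩

/-- `Precedes w a b` means that `a` and `b` occur in `w`, with `a` strictly to the left of `b`
(words have no repeated letters). -/
def Precedes (w : List ℤ) (a b : ℤ) : Prop := [a, b].Sublist w

instance (w : List ℤ) (a b : ℤ) : Decidable (Precedes w a b) :=
  inferInstanceAs (Decidable ([a, b].Sublist w))

/-! ## Horizontal classes in type B and the valuation -/

/-- For a word in `±1, …, ±(n+1)`: the pair `(ε, A)` of the sign `ε` of the letter `±(n+1)` and
the set `A` of the signed letters to the right of `±(n+1)`. -/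
def wordData (n : ℕ) (w : List ℤ) : ℤˣ × Finset ℤ :=
  (if -((n : ℤ) + 1) ∈ w then -1 else 1,
    w.toFinset.filter (fun a => Precedes w ((n : ℤ) + 1) a ∨ Precedes w (-((n : ℤ) + 1)) a))

theorem precedes_cons (x : ℤ) (w : List ℤ) (s c : ℤ) :
    Precedes (x :: w) s c ↔ (s = x ∧ c ∈ w) ∨ Precedes w s c := by
  unfold Precedes
  constructor
  · intro h
    cases h with
    | cons _ h => exact Or.inr h
    | cons_cons _ h => exact Or.inl ⟨rfl, List.singleton_sublist.1 h⟩
  · rintro (⟨rfl, h⟩ | h)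
    · exact (List.singleton_sublist.2 h).cons_cons _
    · exact h.cons _

theorem precedes_swap (l : List ℤ) (a b : ℤ) (r : List ℤ) (s c : ℤ) (ha : s ≠ a) (hb : s ≠ b) :
    Precedes (l ++ a :: b :: r) s c ↔ Precedes (l ++ b :: a :: r) s c := by
  induction l with
  | nil => simp [precedes_cons, ha, hb]
  | cons x l ih =>
    simp only [List.cons_append, precedes_cons, ih, List.mem_append, List.mem_cons]
    tauto

theorem Precedes.mem {w : List ℤ} {s c : ℤ} (h : Precedes w s c) : c ∈ w :=
  h.subset (by simp)

/-- A move not involving `±(n+1)` does not change `(ε, A)`. -/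
theorem wordData_eq_of_move {n : ℕ} {u v : List ℤ} (h : WeakMove u v)
    (hne : u.filter (fun a => a.natAbs ≠ n + 1) ≠ v.filter (fun a => a.natAbs ≠ n + 1)) :
    wordData n u = wordData n v := by
  have key : ∀ s : ℤ, s.natAbs = n + 1 →
      (s ∈ u ↔ s ∈ v) ∧ ∀ c, (Precedes u s c ↔ Precedes v s c) := by
    intro s hs
    rcases h with ⟨l, a, b, r, hab, rfl, rfl⟩ | ⟨a, r, ha, rfl, rfl⟩
    · have ha : a.natAbs ≠ n + 1 := by
        intro h; apply hne; simp [List.filter_append, List.filter_cons, h]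
      have hb : b.natAbs ≠ n + 1 := by
        intro h; apply hne; simp [List.filter_append, List.filter_cons, h]
      refine ⟨by simp only [List.mem_append, List.mem_cons]; tauto, fun c => ?_⟩
      exact precedes_swap l a b r s c (by rintro rfl; exact ha hs) (by rintro rfl; exact hb hs)
    · have ha' : a.natAbs ≠ n + 1 := by
        intro h; apply hne; simp [h]
      have h1 : s ≠ a := by rintro rfl; exact ha' hs
      have h2 : s ≠ -a := by rintro rfl; exact ha' (by simpa using hs)
      simp [precedes_cons, h1, h2]
  have k1 := key ((n : ℤ) + 1) (by omega)
  have k2 := key (-((n : ℤ) + 1)) (by omega)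
  unfold wordData
  refine Prod.ext ?_ ?_
  · simp only [k2.1]
  · ext c
    simp only [Finset.mem_filter, List.mem_toFinset]
    constructor
    · rintro ⟨-, h⟩
      have h' : Precedes v ((n : ℤ) + 1) c ∨ Precedes v (-((n : ℤ) + 1)) c := by
        rwa [← k1.2, ← k2.2]
      exact ⟨h'.elim Precedes.mem Precedes.mem, h'⟩
    · rintro ⟨-, h⟩
      have h' : Precedes u ((n : ℤ) + 1) c ∨ Precedes u (-((n : ℤ) + 1)) c := by
        rwa [k1.2, k2.2]
      exact ⟨h'.elim Precedes.mem Precedes.mem, h'⟩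

theorem weakMove_of_covBy {n : ℕ} {u v : SignedWord n} (h : u ⋖ v) : WeakMove u.1 v.1 := by
  have hle : ReflTransGen (fun x y : SignedWord n => WeakMove x.1 y.1) u v := h.le
  rcases ReflTransGen.cases_head hle with rfl | ⟨x, hx, hxv⟩
  · exact absurd rfl h.ne
  · have hux : u ≤ x := ReflTransGen.single hx
    have hne : u ≠ x := by
      rintro rfl
      exact lt_irrefl _ hx.potential_lt
    have hxv' : x ≤ v := hxv
    have : x = v := (h.eq_or_eq hux hxv').resolve_left (Ne.symm hne)
    exact this ▸ hx

/-- The pair `(ε, A)` attached to a vertex of the pre-Reeb graph of `W_{n+1} → W_n`. -/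
def classData (n : ℕ) : HorizontalClass (deletion n) → ℤˣ × Finset ℤ :=
  Quotient.lift (fun w : SignedWord (n + 1) => wordData n w.1) (by
    intro u v huv
    have huv' : EqvGen (HorizontalCover (deletion n)) u v := huv
    induction huv' with
    | rel u v h =>
      exact wordData_eq_of_move (weakMove_of_covBy h.1)
        (fun he => h.2.ne (Subtype.ext he))
    | refl => rfl
    | symm u v h ih => exact (ih h).symm
    | trans u v w h₁ h₂ ih₁ ih₂ => exact (ih₁ h₁).trans (ih₂ h₂))

/-- The bit `(-N)(ε, A)`. -/
def bitOne (x : ℤˣ × Finset ℤ) : ℕ := if x.1 = -1 then 1 else 0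

/-- The bit `(N, a)(ε, A)`, for a signed letter `a = ±i` with `1 ≤ i < N`:
`1` if `a ∈ A`, plus `1` if `ε = -` and neither `i` nor `-i` lies in `A`. -/
def bitTwo (x : ℤˣ × Finset ℤ) (a : ℤ) : ℕ :=
  (if a ∈ x.2 then 1 else 0) + (if x.1 = -1 ∧ a ∉ x.2 ∧ -a ∉ x.2 then 1 else 0)

/-- The binary valuation on pairs `(ε, A)`, with `N = n + 1`: the integer with binary string
`(N,n) … (N,1) (-N) (N,-1) … (N,-n)`. -/
def pairValuation (n : ℕ) (x : ℤˣ × Finset ℤ) : ℕ :=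
  ∑ i ∈ Finset.Icc 1 n, bitTwo x (-(i : ℤ)) * 2 ^ (n - i) + bitOne x * 2 ^ n +
    ∑ i ∈ Finset.Icc 1 n, bitTwo x (i : ℤ) * 2 ^ (n + i)

/-- The valuation `ν` on the vertices of the (augmented) pre-Reeb graph of `W_{n+1} → W_n`. -/
def valuation (n : ℕ) (x : HorizontalClass (deletion n)) : ℕ := pairValuation n (classData n x)

/-- The formal symbols `(-i)`, `(j, -i)` and `(j, i)`. -/
inductive InvSymbol : Type
  | neg (i : ℕ) : InvSymbol
  | pairNeg (j i : ℕ) : InvSymbol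
  | pairPos (j i : ℕ) : InvSymbol

/-- The inversion set of a signed word in type B. -/
def Inversions {n : ℕ} (w : SignedWord n) : Set InvSymbol
  | .neg i => 1 ≤ i ∧ i ≤ n ∧ -(i : ℤ) ∈ w.1
  | .pairNeg j i => 1 ≤ i ∧ i < j ∧ j ≤ n ∧
      (Precedes w.1 j (-i) ∨ Precedes w.1 (-j) (-i) ∨ Precedes w.1 i (-j) ∨ Precedes w.1 (-i) (-j))
  | .pairPos j i => 1 ≤ i ∧ i < j ∧ j ≤ n ∧
      (Precedes w.1 j i ∨ Precedes w.1 (-j) i ∨ Precedes w.1 i (-j) ∨ Precedes w.1 (-i) (-j))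

open Classical in
/-- The integer whose binary string is the characteristic string of the `(n+1)`-inversions of `w`,
in the order `(N,n), …, (N,1), (-N), (N,-1), …, (N,-n)` with `N = n + 1`. -/
noncomputable def inversionValuation (n : ℕ) (w : SignedWord (n + 1)) : ℕ :=
  ∑ i ∈ Finset.Icc 1 n, (if InvSymbol.pairNeg (n + 1) i ∈ Inversions w then 1 else 0) * 2 ^ (n - i)
    + (if InvSymbol.neg (n + 1) ∈ Inversions w then 1 else 0) * 2 ^ n
    + ∑ i ∈ Finset.Icc 1 n,
        (if InvSymbol.pairPos (n + 1) i ∈ Inversions w then 1 else 0) * 2 ^ (n + i)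

/-! ## Compatible coordinates on the deletion tower -/

/-- `c 0, …, c N` are order-embedding cubic realizations of `W_0, …, W_N`, each compatible with
the previous one under deletion (the values `c k` for `k > N` are irrelevant). -/
def IsCompatibleTower (N : ℕ) (c : (k : ℕ) → SignedWord k → Fin k → ℝ) : Prop :=
  (∀ k ≤ N, IsOrderEmbeddingCubicRealization (c k)) ∧
    ∀ k < N, IsCompatibleLift (deletion k) (c k) (c (k + 1))

/-! Replace a word `a₁ ⋯ aₙ` by the full word `-aₙ ⋯ -a₁ 0 a₁ ⋯ aₙ`, whose position function is odd.
A pair `x < y` in `[-n, n]` is inverted if `y` stands before `x`. Each upward move creates one new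
inverted pair together with the pairs forced by oddness, so the weak order is inclusion of inversion
sets (`le_iff_pos`) and the moves are exactly the covers.

Write `N = n + 1`. For `|x| ≤ n` let the bit of `w` at `x` record whether `N` stands before `x` in
the full word. By oddness these bits account for all inversions involving `±N`, hence `v ≤ w` iff
the deletions satisfy this relation and each bit of `v` is at most that of `w` (`le_iff_deletion`).
The bit at `0` is the sign of `±N`, and `ν` is the binary number with these bits, the letter `x`
having weight `2 ^ (n + x)`. The crucial fact is `value_lt_of_not_le`: if the deletion of `w` is
below that of `v` but `w` is not below `v`, the value of `v` is smaller. Thus `v ≤ w` iff the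
deletion and the value both weakly increase, and every edge of the augmented graph strictly raises
`ν`, which gives acyclicity.

The letters `±N` cut the full word into three blocks, of grades `-1`, `0`, `1`. Bits determine the
grades, and the words with given bits have a largest member, in which each block is decreasing;
joining every word to it by horizontal covers shows that classes are the same as values
(`horizontalClass_eq_iff`). A class is therefore a sign and a grade for each of `1, …, n`, which
gives the count `2 * 3 ^ n`. For two consecutive values, the largest word of the lower class and the
smallest word of the upper class have comparable deletions, because consecutive bit sequences never
reverse a strict comparison of grades (`letterGrade_compatible_of_consecutive`). This yields a path,
so reachability is the total order of `ν`.

In a compatible realization the new coordinate is constant on horizontal covers and increases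
strictly along every edge, hence along `ν`; the description of the order by deletion and value gives
the converse. Induction on the tower finishes the proof. -/

/-! ### Signed positions of letters. -/

/-- The signed position of `x`: the letters of the list have positions `k, k + 1, …`, and the
opposite of a letter has the opposite position. -/
def signedPos : ℤ → List ℤ → ℤ → ℤ
  | _, [], _ => 0
  | k, a :: l, x =>
    (if a = x then k else 0) - (if a = -x then k else 0) + signedPos (k + 1) l x

theorem signedPos_neg (k : ℤ) (l : List ℤ) (x : ℤ) : signedPos k l (-x) = -signedPos k l x := by
  induction l generalizing k with
  | nil => simp [signedPos]
  | cons a l ih => simp only [signedPos, ih, neg_neg]; ring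

theorem signedPos_append (k : ℤ) (l m : List ℤ) (x : ℤ) :
    signedPos k (l ++ m) x = signedPos k l x + signedPos (k + l.length) m x := by
  induction l generalizing k with
  | nil => simp [signedPos]
  | cons a l ih =>
    simp only [List.cons_append, signedPos, ih, List.length_cons]
    push_cast
    ring_nf

theorem signedPos_eq_zero (k : ℤ) (l : List ℤ) (x : ℤ) (h : x.natAbs ∉ l.map Int.natAbs) :
    signedPos k l x = 0 := by
  induction l generalizing k with
  | nil => simp [signedPos]
  | cons a l ih =>
    simp only [List.map_cons, List.mem_cons, not_or] at h
    have h1 : a ≠ x := by rintro rfl; exact h.1 rfl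
    have h2 : a ≠ -x := by rintro rfl; exact h.1 (by simp)
    simp [signedPos, h1, h2, ih _ h.2]

/-- Lists of nonzero integers with distinct absolute values. -/
structure AbsNodup (l : List ℤ) : Prop where
  nodup : (l.map Int.natAbs).Nodup
  zero_notMem : (0 : ℤ) ∉ l

theorem AbsNodup.of_cons {a : ℤ} {l : List ℤ} (h : AbsNodup (a :: l)) :
    AbsNodup l ∧ a.natAbs ∉ l.map Int.natAbs ∧ a ≠ 0 := by
  have h1 := h.nodup
  have h2 := h.zero_notMem
  simp only [List.map_cons, List.nodup_cons] at h1
  simp only [List.mem_cons, not_or] at h2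
  exact ⟨⟨h1.2, h2.2⟩, h1.1, fun e => h2.1 e.symm⟩

theorem signedPos_cons_self (k : ℤ) {a : ℤ} {l : List ℤ} (h : AbsNodup (a :: l)) :
    signedPos k (a :: l) a = k := by
  obtain ⟨-, h1, h2⟩ := h.of_cons
  have : a ≠ -a := by omega
  simp [signedPos, this, signedPos_eq_zero _ _ _ h1]

theorem signedPos_cons_ne (k : ℤ) {a x : ℤ} {l : List ℤ} (h : x.natAbs ≠ a.natAbs) :
    signedPos k (a :: l) x = signedPos (k + 1) l x := by
  have h1 : a ≠ x := by rintro rfl; exact h rfl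
  have h2 : a ≠ -x := by rintro rfl; exact h (by simp)
  simp [signedPos, h1, h2]

theorem natAbs_mem_map_of_mem {x : ℤ} {l : List ℤ} (h : x ∈ l) : x.natAbs ∈ l.map Int.natAbs :=
  List.mem_map_of_mem h

theorem le_signedPos {l : List ℤ} (hl : AbsNodup l) {k x : ℤ} (hx : x ∈ l) :
    k ≤ signedPos k l x := by
  induction l generalizing k with
  | nil => simp at hx
  | cons a l ih =>
    obtain ⟨h0, h1, -⟩ := hl.of_cons
    rcases List.mem_cons.1 hx with rfl | hx
    · rw [signedPos_cons_self k hl]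
    · rw [signedPos_cons_ne]
      · have := ih h0 (k := k + 1) hx
        omega
      · intro e; exact h1 (e ▸ natAbs_mem_map_of_mem hx)

theorem signedPos_pos_iff {l : List ℤ} (hl : AbsNodup l) {k : ℤ} (hk : 1 ≤ k) {x : ℤ} :
    0 < signedPos k l x ↔ x ∈ l := by
  constructor
  · intro h
    by_contra hx
    by_cases hx' : -x ∈ l
    · have := le_signedPos hl (k := k) hx'
      rw [signedPos_neg] at this
      omega
    · rw [signedPos_eq_zero] at h
      · omega
      · intro hm
        obtain ⟨y, hy, hxy⟩ := List.mem_map.1 hm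
        rcases Int.natAbs_eq_natAbs_iff.1 hxy with rfl | rfl
        · exact hx hy
        · exact hx' hy
  · intro h
    have := le_signedPos hl (k := k) h
    omega

/-- Positivity of the position selects the letters that occur with their own sign. This turns
statements about sublists into linear arithmetic on positions. -/
theorem precedes_iff_signedPos {l : List ℤ} (hl : AbsNodup l) {k : ℤ} (hk : 1 ≤ k) {x y : ℤ} :
    Precedes l x y ↔ 0 < signedPos k l x ∧ signedPos k l x < signedPos k l y := by
  induction l generalizing k with
  | nil => simp [Precedes, signedPos]
  | cons a l ih =>
    obtain ⟨h0, h1, h2⟩ := hl.of_cons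
    have hmem : ∀ z, z ∈ l → z.natAbs ≠ a.natAbs := fun z hz e =>
      h1 (e ▸ natAbs_mem_map_of_mem hz)
    have hP : ∀ z, Precedes l z y → z ∈ l := fun z hz => hz.subset (by simp)
    have hk1 : (1 : ℤ) ≤ k + 1 := by omega
    have hpos : ∀ z, 0 < signedPos (k + 1) l z → k + 1 ≤ signedPos (k + 1) l z := fun z hz =>
      le_signedPos h0 ((signedPos_pos_iff h0 hk1).1 hz)
    rw [precedes_cons]
    have hself := signedPos_cons_self k hl
    have hnself : signedPos k (a :: l) (-a) = -k := by rw [signedPos_neg, hself]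
    by_cases hx : x.natAbs = a.natAbs
    · have hxl : x ∉ l := fun h => hmem x h hx
      have hxP : ¬ Precedes l x y := fun h => hxl (hP x h)
      rcases Int.natAbs_eq_natAbs_iff.1 hx with rfl | rfl
      · rw [hself]
        by_cases hy : y.natAbs = x.natAbs
        · have : y ∉ l := fun h => hmem y h hy
          rcases Int.natAbs_eq_natAbs_iff.1 hy with rfl | rfl
          · rw [hself]; simp [this, hxP]
          · rw [hnself]; simp only [this, hxP]; simp; omega
        · rw [signedPos_cons_ne k hy]
          have := signedPos_pos_iff h0 hk1 (x := y)
          have := hpos y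
          constructor
          · rintro (⟨-, h⟩ | h)
            · have := le_signedPos h0 (k := k + 1) h
              omega
            · exact absurd h hxP
          · intro h
            exact Or.inl ⟨rfl, by rw [← signedPos_pos_iff h0 hk1]; omega⟩
      · rw [hnself]
        have : -a ≠ a := by omega
        simp only [this, hxP]
        simp
        omega
    · have hxa : x ≠ a := by rintro rfl; exact hx rfl
      rw [signedPos_cons_ne k hx]
      by_cases hy : y.natAbs = a.natAbs
      · have hyl : y ∉ l := fun h => hmem y h hy
        have hyP : ¬ Precedes l x y := fun h => hyl h.mem
        have := hpos x
        rcases Int.natAbs_eq_natAbs_iff.1 hy with rfl | rfl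
        · rw [hself]
          simp only [hxa, hyP]; simp; omega
        · rw [hnself]
          simp only [hxa, hyP]; simp; omega
      · rw [signedPos_cons_ne k hy, ← ih h0 hk1]
        simp [hxa]

theorem signedPos_inj {l : List ℤ} (hl : AbsNodup l) {k : ℤ} {x y : ℤ}
    (hx : x ∈ l) (hy : y ∈ l) (h : signedPos k l x = signedPos k l y) : x = y := by
  induction l generalizing k with
  | nil => simp at hx
  | cons a l ih =>
    obtain ⟨h0, h1, h2⟩ := hl.of_cons
    have hmem : ∀ z, z ∈ l → z.natAbs ≠ a.natAbs := fun z hz e =>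
      h1 (e ▸ natAbs_mem_map_of_mem hz)
    have hself := signedPos_cons_self k hl
    rcases List.mem_cons.1 hx with rfl | hx' <;> rcases List.mem_cons.1 hy with rfl | hy'
    · rfl
    · rw [hself, signedPos_cons_ne k (hmem _ hy')] at h
      have := le_signedPos h0 (k := k + 1) hy'
      omega
    · rw [hself, signedPos_cons_ne k (hmem _ hx')] at h
      have := le_signedPos h0 (k := k + 1) hx'
      omega
    · rw [signedPos_cons_ne k (hmem _ hx'), signedPos_cons_ne k (hmem _ hy')] at h
      exact ih h0 hx' hy' h

namespace SignedWord

variable {n : ℕ}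

/-- The position of `x` in the full word `-aₙ ⋯ -a₁ 0 a₁ ⋯ aₙ`, with `0` at the origin. -/
def pos (w : SignedWord n) (x : ℤ) : ℤ := signedPos 1 w.1 x

theorem absNodup (w : SignedWord n) : AbsNodup w.1 where
  nodup := w.2.nodup_iff.2 List.nodup_range'
  zero_notMem h := by
    have := w.2.mem_iff.1 (natAbs_mem_map_of_mem h)
    simp at this

theorem mem_bounds (w : SignedWord n) {x : ℤ} (h : x ∈ w.1) : 1 ≤ x.natAbs ∧ x.natAbs ≤ n := by
  have := w.2.mem_iff.1 (natAbs_mem_map_of_mem h)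
  simp [List.mem_range'_1] at this
  omega

theorem mem_or_neg_mem (w : SignedWord n) {x : ℤ} (h1 : x ≠ 0) (h : x.natAbs ≤ n) :
    x ∈ w.1 ∨ -x ∈ w.1 := by
  have : x.natAbs ∈ w.1.map Int.natAbs := by
    rw [w.2.mem_iff, List.mem_range'_1]; omega
  obtain ⟨y, hy, hxy⟩ := List.mem_map.1 this
  rcases Int.natAbs_eq_natAbs_iff.1 hxy with rfl | rfl
  · exact Or.inl hy
  · exact Or.inr hy

theorem pos_neg (w : SignedWord n) (x : ℤ) : w.pos (-x) = -w.pos x := signedPos_neg _ _ _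

theorem pos_zero (w : SignedWord n) : w.pos 0 = 0 := by
  have := w.pos_neg 0
  rw [neg_zero] at this
  omega

theorem pos_pos_iff (w : SignedWord n) {x : ℤ} : 0 < w.pos x ↔ x ∈ w.1 :=
  signedPos_pos_iff w.absNodup le_rfl

theorem pos_neg_iff (w : SignedWord n) {x : ℤ} : w.pos x < 0 ↔ -x ∈ w.1 := by
  rw [← pos_pos_iff, pos_neg]; omega

theorem precedes_iff (w : SignedWord n) {x y : ℤ} :
    Precedes w.1 x y ↔ 0 < w.pos x ∧ w.pos x < w.pos y :=
  precedes_iff_signedPos w.absNodup le_rfl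

theorem pos_ne_zero (w : SignedWord n) {x : ℤ} (h1 : x ≠ 0) (h : x.natAbs ≤ n) : w.pos x ≠ 0 := by
  rcases w.mem_or_neg_mem h1 h with h | h
  · exact (w.pos_pos_iff.2 h).ne'
  · exact (w.pos_neg_iff.2 h).ne

theorem pos_inj (w : SignedWord n) {x y : ℤ} (hx : x.natAbs ≤ n) (hy : y.natAbs ≤ n)
    (h : w.pos x = w.pos y) : x = y := by
  rcases lt_trichotomy (w.pos x) 0 with h0 | h0 | h0
  · have h1 := w.pos_neg_iff.1 h0
    have h2 := w.pos_neg_iff.1 (h ▸ h0)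
    have h3 : w.pos (-x) = w.pos (-y) := by rw [pos_neg, pos_neg, h]
    exact neg_injective (signedPos_inj w.absNodup h1 h2 h3)
  · have h1 : x = 0 := by by_contra hne; exact w.pos_ne_zero hne hx h0
    have h2 : y = 0 := by by_contra hne; exact w.pos_ne_zero hne hy (h ▸ h0)
    rw [h1, h2]
  · exact signedPos_inj w.absNodup (w.pos_pos_iff.1 h0) (w.pos_pos_iff.1 (h ▸ h0)) h

theorem length_eq (w : SignedWord n) : w.1.length = n := by
  have := w.2.length_eq
  simpa using this

/-- Comparing two odd position functions reduces to the positive half. -/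
theorem lt_of_lt_of_odd {p q : ℤ → ℤ} (hp : ∀ x, p (-x) = -p x) (hq : ∀ x, q (-x) = -q x)
    (hp0 : ∀ x : ℤ, x.natAbs ≤ n → p x = 0 → x = 0)
    (h1 : ∀ x : ℤ, x.natAbs ≤ n → 0 < p x → 0 < q x)
    (h2 : ∀ x y : ℤ, x.natAbs ≤ n → y.natAbs ≤ n → 0 < p x → p x < p y → q x < q y)
    {x y : ℤ} (hx : x.natAbs ≤ n) (hy : y.natAbs ≤ n) (h : p x < p y) : q x < q y := by
  have hq0 : q 0 = 0 := by have := hq 0; rw [neg_zero] at this; omega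
  have hx' : (-x).natAbs ≤ n := by simpa using hx
  have hy' : (-y).natAbs ≤ n := by simpa using hy
  have a1 := h1 x hx
  have a2 := h1 y hy
  have a3 := h1 (-x) hx'
  have a4 := h1 (-y) hy'
  have a5 := h2 x y hx hy
  have a6 := h2 (-y) (-x) hy' hx'
  rw [hp, hq] at a3 a4
  rw [hp, hq, hp, hq] at a6
  by_cases hx0 : p x = 0
  · have := hp0 x hx hx0
    subst this
    omega
  · by_cases hy0 : p y = 0
    · have := hp0 y hy hy0
      subst this
      omega
    · omega

end SignedWord

/-! ### Moves, inversions, and the weak order as inclusion of inversion sets. -/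

namespace SignedWord

variable {n : ℕ}

theorem pos_swap {u v : SignedWord n} {l r : List ℤ} {a b : ℤ}
    (hu : u.1 = l ++ a :: b :: r) (hv : v.1 = l ++ b :: a :: r) :
    u.pos a = l.length + 1 ∧ u.pos b = l.length + 2 ∧
    ∀ x, v.pos x = u.pos x + ((if a = x then 1 else 0) - (if a = -x then 1 else 0))
      - ((if b = x then 1 else 0) - (if b = -x then 1 else 0)) := by
  have hnd := u.absNodup.nodup
  have h0 := u.absNodup.zero_notMem
  have hsub : AbsNodup (a :: b :: r) := by
    rw [hu] at hnd h0
    rw [List.map_append, List.nodup_append] at hnd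
    exact ⟨hnd.2.1, fun h => h0 (List.mem_append_right _ h)⟩
  have hal : a.natAbs ∉ l.map Int.natAbs ∧ b.natAbs ∉ l.map Int.natAbs := by
    rw [hu, List.map_append, List.nodup_append] at hnd
    exact ⟨fun h => hnd.2.2 _ h a.natAbs (by simp) rfl,
      fun h => hnd.2.2 _ h b.natAbs (by simp) rfl⟩
  obtain ⟨hb, hab, -⟩ := hsub.of_cons
  have hab' : b.natAbs ≠ a.natAbs := by
    intro h; apply hab; simp [h]
  refine ⟨?_, ?_, fun x => ?_⟩
  · rw [pos, hu, signedPos_append, signedPos_eq_zero _ _ _ hal.1, signedPos_cons_self _ hsub]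
    ring
  · rw [pos, hu, signedPos_append, signedPos_eq_zero _ _ _ hal.2, signedPos_cons_ne _ hab',
      signedPos_cons_self _ hb]
    ring
  · rw [pos, pos, hu, hv, signedPos_append, signedPos_append]
    simp only [signedPos]
    split_ifs <;> ring

theorem pos_flip {u v : SignedWord n} {r : List ℤ} {a : ℤ}
    (hu : u.1 = a :: r) (hv : v.1 = (-a) :: r) :
    u.pos a = 1 ∧
    ∀ x, v.pos x = u.pos x - 2 * ((if a = x then 1 else 0) - (if a = -x then 1 else 0)) := by
  refine ⟨?_, fun x => ?_⟩
  · rw [pos, hu, signedPos_cons_self]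
    rw [← hu]; exact u.absNodup
  · rw [pos, pos, hu, hv]
    simp only [signedPos]
    have e1 : (-a = x) = (a = -x) := by apply propext; omega
    have e2 : (-a = -x) = (a = x) := by apply propext; omega
    rw [if_congr (iff_of_eq e1) rfl rfl, if_congr (iff_of_eq e2) rfl rfl]
    split_ifs <;> ring

/-- `v` arises from `u` by inverting the pair `a < b` (and those forced by symmetry). -/
structure InvertsPair (u v : SignedWord n) (a b : ℤ) : Prop where
  lt : a < b
  left_le : a.natAbs ≤ n
  right_le : b.natAbs ≤ n
  before : u.pos a < u.pos b
  after : v.pos b < v.pos a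
  mono : ∀ x y : ℤ, x.natAbs ≤ n → y.natAbs ≤ n → x < y → u.pos y < u.pos x → v.pos y < v.pos x
  -- Quantifying over all words `c` expresses that the new pair is inverted together with `(a, b)`
  -- for reasons of symmetry alone. This is what makes every move a cover.
  only : ∀ x y : ℤ, x.natAbs ≤ n → y.natAbs ≤ n → x < y → v.pos y < v.pos x →
    u.pos y < u.pos x ∨ ∀ c : SignedWord n, c.pos y < c.pos x ↔ c.pos b < c.pos a

/-- Only `±a` and `±b` move, each past its neighbour, so the new inverted pairs are `(a, b)` and its
mirror image `(-b, -a)`. -/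
theorem invertsPair_swap {u v : SignedWord n} {l r : List ℤ} {a b : ℤ} (hab : a < b)
    (hu : u.1 = l ++ a :: b :: r) (hv : v.1 = l ++ b :: a :: r) : InvertsPair u v a b := by
  obtain ⟨h1, h2, h3⟩ := pos_swap hu hv
  have ha := u.mem_bounds (x := a) (by simp [hu])
  have hb := u.mem_bounds (x := b) (by simp [hu])
  have hk : (0 : ℤ) ≤ l.length := by positivity
  generalize (l.length : ℤ) = k at *
  have hne : a ≠ -b := by
    rintro rfl; rw [pos_neg] at h1; omega
  have hcases : ∀ x : ℤ, x.natAbs ≤ n →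
      (x = a ∧ u.pos x = k + 1 ∧ v.pos x = k + 2) ∨ (x = b ∧ u.pos x = k + 2 ∧ v.pos x = k + 1) ∨
      (x = -a ∧ u.pos x = -(k + 1) ∧ v.pos x = -(k + 2)) ∨
      (x = -b ∧ u.pos x = -(k + 2) ∧ v.pos x = -(k + 1)) ∨
      (v.pos x = u.pos x ∧ u.pos x ≠ k + 1 ∧ u.pos x ≠ k + 2 ∧ u.pos x ≠ -(k + 1)
        ∧ u.pos x ≠ -(k + 2)) := by
    intro x hx
    have e1 : u.pos x = k + 1 → x = a := fun h => u.pos_inj hx ha.2 (h.trans h1.symm)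
    have e2 : u.pos x = k + 2 → x = b := fun h => u.pos_inj hx hb.2 (h.trans h2.symm)
    have e3 : u.pos x = -(k + 1) → x = -a := fun h =>
      u.pos_inj hx (by simpa using ha.2) (by rw [h, pos_neg, h1])
    have e4 : u.pos x = -(k + 2) → x = -b := fun h =>
      u.pos_inj hx (by simpa using hb.2) (by rw [h, pos_neg, h2])
    have h4 := h3 x
    by_cases c1 : x = a
    · subst c1; left
      rw [if_pos rfl, if_neg (by omega), if_neg (by omega), if_neg (by omega)] at h4
      omega
    by_cases c2 : x = b
    · subst c2; right; left
      rw [if_neg (by omega), if_neg (by omega), if_pos rfl, if_neg (by omega)] at h4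
      omega
    by_cases c3 : x = -a
    · subst c3; right; right; left
      rw [if_neg (by omega), if_pos (by omega), if_neg (by omega), if_neg (by omega)] at h4
      have e5 := u.pos_neg a
      have e6 := v.pos_neg a
      omega
    by_cases c4 : x = -b
    · subst c4; right; right; right; left
      rw [if_neg (by omega), if_neg (by omega), if_neg (by omega), if_pos (by omega)] at h4
      have e5 := u.pos_neg b
      have e6 := v.pos_neg b
      omega
    right; right; right; right
    rw [if_neg (by omega), if_neg (by omega), if_neg (by omega), if_neg (by omega)] at h4
    refine ⟨by omega, fun h => c1 (e1 h), fun h => c2 (e2 h), fun h => c3 (e3 h),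
      fun h => c4 (e4 h)⟩
  have hca := hcases a ha.2
  have hcb := hcases b hb.2
  refine ⟨hab, ha.2, hb.2, by omega, by omega, fun x y hx hy hxy h => ?_,
    fun x y hx hy hxy h => ?_⟩
  · rcases hcases x hx with c | c | c | c | c <;> rcases hcases y hy with d | d | d | d | d <;>
      omega
  · rw [or_iff_not_imp_left]
    intro hn c
    have : (x = a ∧ y = b) ∨ (x = -b ∧ y = -a) := by
      rcases hcases x hx with c | c | c | c | c <;> rcases hcases y hy with d | d | d | d | d <;>
        omega
    rcases this with ⟨rfl, rfl⟩ | ⟨rfl, rfl⟩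
    · rfl
    · rw [pos_neg, pos_neg]; omega

/-- The letters `-a, 0, a` occupy positions `-1, 0, 1` and are reversed. By oddness each of the
three resulting pairs is inverted in a word exactly when the others are. -/
theorem invertsPair_flip {u v : SignedWord n} {r : List ℤ} {a : ℤ} (h0 : 0 < a)
    (hu : u.1 = a :: r) (hv : v.1 = (-a) :: r) : InvertsPair u v (-a) a := by
  obtain ⟨h1, h3⟩ := pos_flip hu hv
  have ha := u.mem_bounds (x := a) (by simp [hu])
  have hcases : ∀ x : ℤ, x.natAbs ≤ n →
      (x = a ∧ u.pos x = 1 ∧ v.pos x = -1) ∨ (x = -a ∧ u.pos x = -1 ∧ v.pos x = 1) ∨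
      (x = 0 ∧ u.pos x = 0 ∧ v.pos x = 0) ∨
      (v.pos x = u.pos x ∧ u.pos x ≠ 1 ∧ u.pos x ≠ -1 ∧ u.pos x ≠ 0) := by
    intro x hx
    have e1 : u.pos x = 1 → x = a := fun h => u.pos_inj hx ha.2 (h.trans h1.symm)
    have e3 : u.pos x = -1 → x = -a := fun h =>
      u.pos_inj hx (by simpa using ha.2) (by rw [h, pos_neg, h1])
    have e0 : u.pos x = 0 → x = 0 := fun h => u.pos_inj hx (by simp) (by rw [h, pos_zero])
    have h4 := h3 x
    by_cases c1 : x = a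
    · subst c1; left
      rw [if_pos rfl, if_neg (by omega)] at h4
      omega
    by_cases c3 : x = -a
    · subst c3; right; left
      rw [if_neg (by omega), if_pos (by omega)] at h4
      have e5 := u.pos_neg a
      have e6 := v.pos_neg a
      omega
    by_cases c0 : x = 0
    · subst c0; right; right; left
      rw [pos_zero, pos_zero]; omega
    right; right; right
    rw [if_neg (by omega), if_neg (by omega)] at h4
    refine ⟨by omega, fun h => c1 (e1 h), fun h => c3 (e3 h), fun h => c0 (e0 h)⟩
  have hca := hcases a ha.2
  have hu0 := u.pos_neg a
  have hv0 := v.pos_neg a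
  refine ⟨by omega, by simpa using ha.2, ha.2, by omega, by omega, fun x y hx hy hxy h => ?_,
    fun x y hx hy hxy h => ?_⟩
  · rcases hcases x hx with c | c | c | c <;> rcases hcases y hy with d | d | d | d <;> omega
  · rw [or_iff_not_imp_left]
    intro hn c
    have : (x = -a ∧ y = a) ∨ (x = -a ∧ y = 0) ∨ (x = 0 ∧ y = a) := by
      rcases hcases x hx with c | c | c | c <;> rcases hcases y hy with d | d | d | d <;> omega
    have hc0 := c.pos_zero
    rcases this with ⟨rfl, rfl⟩ | ⟨rfl, rfl⟩ | ⟨rfl, rfl⟩ <;> simp only [pos_neg] <;> omega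

theorem exists_invertsPair_of_weakMove {u v : SignedWord n} (h : WeakMove u.1 v.1) :
    ∃ a b, InvertsPair u v a b := by
  rcases h with ⟨l, a, b, r, hab, hu, hv⟩ | ⟨a, r, ha, hu, hv⟩
  · exact ⟨a, b, invertsPair_swap hab hu hv⟩
  · exact ⟨-a, a, invertsPair_flip ha hu hv⟩

theorem le_of_weakMove {u v : SignedWord n} (h : WeakMove u.1 v.1) : u ≤ v :=
  ReflTransGen.single h

theorem pos_lt_of_le {u v : SignedWord n} (h : u ≤ v) {x y : ℤ} (hx : x.natAbs ≤ n)
    (hy : y.natAbs ≤ n) (hxy : x < y) (hinv : u.pos y < u.pos x) : v.pos y < v.pos x := by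
  have h' : ReflTransGen (fun x y : SignedWord n => WeakMove x.1 y.1) u v := h
  induction h' with
  | refl => exact hinv
  | tail hab hbc ih =>
    obtain ⟨a, b, hp⟩ := exists_invertsPair_of_weakMove hbc
    exact hp.mono x y hx hy hxy (ih hab)

/-- A swap of a signed word. -/
theorem exists_swap {u : SignedWord n} {l r : List ℤ} {a b : ℤ} (hu : u.1 = l ++ a :: b :: r) :
    ∃ v : SignedWord n, v.1 = l ++ b :: a :: r := by
  refine ⟨⟨l ++ b :: a :: r, ?_⟩, rfl⟩
  have h := u.2
  rw [hu] at h
  refine List.Perm.trans (List.Perm.map _ ?_) h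
  exact (List.Perm.swap a b r).append_left l

theorem exists_flip {u : SignedWord n} {r : List ℤ} {a : ℤ} (hu : u.1 = a :: r) :
    ∃ v : SignedWord n, v.1 = (-a) :: r := by
  refine ⟨⟨(-a) :: r, ?_⟩, rfl⟩
  have h := u.2
  rw [hu] at h
  simpa using h

/-- If every adjacent pair of `u` is in the same order in `v`, then `u = v`. -/
theorem eq_of_adjacent {u v : SignedWord n}
    (hhead : ∀ a r, u.1 = a :: r → 0 < v.pos a)
    (hadj : ∀ l a b r, u.1 = l ++ a :: b :: r → v.pos a < v.pos b) : u = v := by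
  have hsort : ∀ (m : List ℤ), (∀ l a b r, m = l ++ a :: b :: r → v.pos a < v.pos b) →
      m.Pairwise (fun a b => v.pos a < v.pos b) := by
    intro m hm
    have : IsTrans ℤ (fun a b => v.pos a < v.pos b) := ⟨fun _ _ _ h1 h2 => lt_trans h1 h2⟩
    rw [← List.isChain_iff_pairwise]
    induction m with
    | nil => exact List.isChain_nil
    | cons a m ih =>
      have := ih (fun l c d r e => hm (a :: l) c d r (by simp [e]))
      cases m with
      | nil => exact List.isChain_singleton _
      | cons b m => exact List.isChain_cons_cons.2 ⟨hm [] a b m rfl, this⟩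
  have hs := hsort u.1 hadj
  have hpos : ∀ x ∈ u.1, 0 < v.pos x := by
    intro x hx
    cases hu : u.1 with
    | nil => simp [hu] at hx
    | cons a r =>
      have h0 := hhead a r hu
      rw [hu] at hs hx
      rcases List.mem_cons.1 hx with rfl | hx
      · exact h0
      · exact h0.trans (List.rel_of_pairwise_cons hs hx)
  -- Positive positions in `v` mean that both words use the same signs, so they are permutations of
  -- each other sorted by the same strict order.
  have hsub : u.1 ⊆ v.1 := fun x hx => v.pos_pos_iff.1 (hpos x hx)
  have hnd : ∀ w : SignedWord n, w.1.Nodup := fun w => w.absNodup.nodup.of_map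
  have hperm : u.1.Perm v.1 := by
    apply List.Subperm.perm_of_length_le ((hnd u).subperm hsub)
    rw [u.length_eq, v.length_eq]
  have hs' : v.1.Pairwise (fun a b => v.pos a < v.pos b) := by
    apply hsort
    intro l a b r e
    have : Precedes v.1 a b := by
      rw [e]
      exact ((List.nil_sublist r).cons_cons b).cons_cons a |>.trans (List.sublist_append_right _ _)
    exact (v.precedes_iff.1 this).2
  exact Subtype.ext (hperm.eq_of_pairwise (fun a b _ _ h1 h2 => absurd h1 (lt_asymm h2)) hs hs')

open Classical in
/-- The inverted pairs of a signed word. -/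
noncomputable def invertedPairs (w : SignedWord n) : Finset (ℤ × ℤ) :=
  ((Finset.Icc (-(n : ℤ)) n) ×ˢ (Finset.Icc (-(n : ℤ)) n)).filter
    (fun p => p.1 < p.2 ∧ w.pos p.2 < w.pos p.1)

theorem mem_invertedPairs {w : SignedWord n} {x y : ℤ} : (x, y) ∈ w.invertedPairs ↔
    x.natAbs ≤ n ∧ y.natAbs ≤ n ∧ x < y ∧ w.pos y < w.pos x := by
  simp only [invertedPairs, Finset.mem_filter, Finset.mem_product, Finset.mem_Icc]
  omega

/-- Below `v`, every `u ≠ v` with fewer inversions admits a move whose inversions stay in `v`. -/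
theorem exists_move_of_subset {u v : SignedWord n} (h : u.invertedPairs ⊆ v.invertedPairs)
    (hne : u ≠ v) : ∃ u' a b, WeakMove u.1 u'.1 ∧ InvertsPair u u' a b ∧ v.pos b < v.pos a := by
  by_contra hcon
  push Not at hcon
  have hinv : ∀ {x y : ℤ}, x.natAbs ≤ n → y.natAbs ≤ n → x < y → u.pos y < u.pos x →
      v.pos y < v.pos x := fun hx hy hxy hp =>
    (mem_invertedPairs.1 (h (mem_invertedPairs.2 ⟨hx, hy, hxy, hp⟩))).2.2.2
  apply hne
  apply eq_of_adjacent
  · intro a r hu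
    have ha := u.mem_bounds (x := a) (by simp [hu])
    have hp := v.pos_ne_zero (x := a) (by omega) ha.2
    rcases lt_or_ge 0 a with h0 | h0
    · obtain ⟨u', hu'⟩ := exists_flip hu
      have := hcon u' (-a) a (Or.inr ⟨a, r, h0, hu, hu'⟩) (invertsPair_flip h0 hu hu')
      rw [pos_neg] at this
      omega
    · have h1 : 0 < u.pos a := u.pos_pos_iff.2 (by simp [hu])
      have := hinv (x := a) (y := 0) ha.2 (by simp) (by omega) (by rwa [pos_zero])
      rwa [pos_zero] at this
  · intro l a b r hu
    have ha := u.mem_bounds (x := a) (by simp [hu])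
    have hb := u.mem_bounds (x := b) (by simp [hu])
    obtain ⟨u', hu'⟩ := exists_swap hu
    obtain ⟨hpa, hpb, -⟩ := pos_swap hu hu'
    have hab : a ≠ b := by rintro rfl; omega
    rcases lt_or_gt_of_ne hab with h0 | h0
    · have := hcon u' a b (Or.inl ⟨l, a, b, r, h0, hu, hu'⟩) (invertsPair_swap h0 hu hu')
      have h2 : v.pos a ≠ v.pos b := fun e => hab (v.pos_inj ha.2 hb.2 e)
      omega
    · exact hinv hb.2 ha.2 h0 (by omega)

/-- Induction on the number of inversions of `v` missing from `u`: a move towards `v` keeps the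
inclusion and lowers this number. -/
theorem le_of_invertedPairs_subset {u v : SignedWord n}
    (h : u.invertedPairs ⊆ v.invertedPairs) : u ≤ v := by
  induction hk : (v.invertedPairs \ u.invertedPairs).card using Nat.strong_induction_on
    generalizing u with
  | _ k ih =>
    by_cases hne : u = v
    · exact hne.le
    · obtain ⟨u', a, b, hm, hp, hv⟩ := exists_move_of_subset h hne
      have hsub : u'.invertedPairs ⊆ v.invertedPairs := by
        rintro ⟨x, y⟩ hxy
        obtain ⟨hx, hy, hlt, hi⟩ := mem_invertedPairs.1 hxy
        rcases hp.only x y hx hy hlt hi with h1 | h1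
        · exact h (mem_invertedPairs.2 ⟨hx, hy, hlt, h1⟩)
        · exact mem_invertedPairs.2 ⟨hx, hy, hlt, (h1 v).2 hv⟩
      have hlt : (v.invertedPairs \ u'.invertedPairs).card < k := by
        rw [← hk]
        apply Finset.card_lt_card
        rw [Finset.ssubset_iff_of_subset]
        · refine ⟨(a, b), ?_, ?_⟩
          · rw [Finset.mem_sdiff, mem_invertedPairs, mem_invertedPairs]
            exact ⟨⟨hp.left_le, hp.right_le, hp.lt, hv⟩, fun h' => lt_asymm hp.before h'.2.2.2⟩
          · rw [Finset.mem_sdiff, not_and_not_right]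
            exact fun _ => mem_invertedPairs.2 ⟨hp.left_le, hp.right_le, hp.lt, hp.after⟩
        · apply Finset.sdiff_subset_sdiff le_rfl
          rintro ⟨x, y⟩ hxy
          obtain ⟨hx, hy, hlt, hi⟩ := mem_invertedPairs.1 hxy
          exact mem_invertedPairs.2 ⟨hx, hy, hlt, hp.mono x y hx hy hlt hi⟩
      exact (le_of_weakMove hm).trans (ih _ hlt hsub rfl)

/-- The weak order is the inclusion order of inversions. -/
theorem le_iff_pos {u v : SignedWord n} : u ≤ v ↔ ∀ x y : ℤ, x.natAbs ≤ n → y.natAbs ≤ n → x < y →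
    u.pos y < u.pos x → v.pos y < v.pos x := by
  refine ⟨fun h x y hx hy hxy => pos_lt_of_le h hx hy hxy, fun h => ?_⟩
  apply le_of_invertedPairs_subset
  rintro ⟨x, y⟩ hxy
  obtain ⟨hx, hy, hlt, hi⟩ := mem_invertedPairs.1 hxy
  exact mem_invertedPairs.2 ⟨hx, hy, hlt, h x y hx hy hlt hi⟩

/-- All new inversions stand or fall with `(a, b)`. An intermediate word that inverts `(a, b)` is
above `v`, and one that does not is below `u`. -/
theorem covBy_of_weakMove {u v : SignedWord n} (h : WeakMove u.1 v.1) : u ⋖ v := by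
  obtain ⟨a, b, hp⟩ := exists_invertsPair_of_weakMove h
  have hlt : u < v := (le_of_weakMove h).lt_of_ne (by
    rintro rfl; exact lt_irrefl _ h.potential_lt)
  refine ⟨hlt, fun c hc1 hc2 => ?_⟩
  have h1 := le_iff_pos.1 hc1.le
  have h2 := le_iff_pos.1 hc2.le
  by_cases hc : c.pos b < c.pos a
  · refine hc2.not_ge (le_iff_pos.2 fun x y hx hy hxy hi => ?_)
    rcases hp.only x y hx hy hxy hi with h' | h'
    · exact h1 x y hx hy hxy h'
    · exact (h' c).2 hc
  · refine hc1.not_ge (le_iff_pos.2 fun x y hx hy hxy hi => ?_)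
    rcases hp.only x y hx hy hxy (h2 x y hx hy hxy hi) with h' | h'
    · exact h'
    · exact absurd ((h' c).1 hi) hc

end SignedWord

namespace SignedWord

variable {n : ℕ}

/-! ### Deletion -/

theorem mem_deletion {w : SignedWord (n + 1)} {x : ℤ} (hx : x.natAbs ≤ n) :
    x ∈ (deletion n w).1 ↔ x ∈ w.1 := by
  simp only [deletion, List.mem_filter, decide_eq_true_eq]
  exact ⟨fun h => h.1, fun h => ⟨h, by omega⟩⟩

theorem precedes_deletion {w : SignedWord (n + 1)} {x y : ℤ} (hx : x.natAbs ≤ n)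
    (hy : y.natAbs ≤ n) : Precedes (deletion n w).1 x y ↔ Precedes w.1 x y := by
  constructor
  · exact fun h => List.Sublist.trans h List.filter_sublist
  · intro h
    have h2 : (List.filter (fun a : ℤ => decide (a.natAbs ≠ n + 1)) [x, y]).Sublist
      (deletion n w).1 := List.Sublist.filter _ h
    rwa [List.filter_eq_self.2] at h2
    intro a ha
    simp only [List.mem_cons, List.not_mem_nil, or_false] at ha
    rcases ha with rfl | rfl <;> simp only [decide_eq_true_eq] <;> omega

/-- In the right half this is precedence in a word against precedence in a sublist; oddness extends
it to the full word. -/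
theorem pos_deletion_lt_iff (w : SignedWord (n + 1)) {x y : ℤ} (hx : x.natAbs ≤ n)
    (hy : y.natAbs ≤ n) : (deletion n w).pos x < (deletion n w).pos y ↔ w.pos x < w.pos y := by
  have h1 : ∀ x : ℤ, x.natAbs ≤ n → (0 < (deletion n w).pos x ↔ 0 < w.pos x) := by
    intro x hx
    rw [pos_pos_iff, pos_pos_iff, mem_deletion hx]
  have h2 : ∀ x y : ℤ, x.natAbs ≤ n → y.natAbs ≤ n → 0 < w.pos x →
      ((deletion n w).pos x < (deletion n w).pos y ↔ w.pos x < w.pos y) := by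
    intro x y hx hy h0
    have := precedes_deletion (w := w) hx hy
    rw [precedes_iff, precedes_iff, h1 x hx] at this
    tauto
  constructor
  · refine lt_of_lt_of_odd (pos_neg _) (pos_neg _) ?_ (fun x hx h => (h1 x hx).1 h) ?_ hx hy
    · intro x hx h
      by_contra hne
      exact pos_ne_zero _ hne hx h
    · exact fun x y hx hy h => (h2 x y hx hy ((h1 x hx).1 h)).1
  · refine lt_of_lt_of_odd (pos_neg _) (pos_neg _) ?_ (fun x hx h => (h1 x hx).2 h) ?_ hx hy
    · intro x hx h
      by_contra hne
      exact pos_ne_zero _ hne (by omega) h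
    · exact fun x y hx hy h => (h2 x y hx hy h).2

/-- The order of deletion words together with the letters passed by `n + 1` in the full word. -/
theorem le_iff_deletion {v w : SignedWord (n + 1)} : v ≤ w ↔ deletion n v ≤ deletion n w ∧
    ∀ x : ℤ, x.natAbs ≤ n → v.pos (n + 1) < v.pos x → w.pos (n + 1) < w.pos x := by
  rw [le_iff_pos, le_iff_pos]
  constructor
  · intro h
    refine ⟨fun x y hx hy hxy => ?_, fun x hx => h x (n + 1) (by omega) (by omega) (by omega)⟩
    rw [pos_deletion_lt_iff _ hy hx, pos_deletion_lt_iff _ hy hx]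
    exact h x y (by omega) (by omega) hxy
  · rintro ⟨h1, h2⟩ x y hx hy hxy hi
    have hN : ∀ u : SignedWord (n + 1), u.pos (-(n + 1)) = - u.pos (n + 1) := fun u => u.pos_neg _
    by_cases hy' : y.natAbs ≤ n
    · by_cases hx' : x.natAbs ≤ n
      · have := h1 x y hx' hy' hxy
        rw [pos_deletion_lt_iff _ hy' hx', pos_deletion_lt_iff _ hy' hx'] at this
        exact this hi
      · obtain rfl : x = -(n + 1) := by omega
        have := h2 (-y) (by omega)
        rw [hN] at *
        rw [pos_neg, pos_neg] at this
        omega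
    · by_cases hx' : x.natAbs ≤ n
      · obtain rfl : y = n + 1 := by omega
        exact h2 x hx' hi
      · obtain rfl : x = -(n + 1) := by omega
        obtain rfl : y = n + 1 := by omega
        have := h2 0 (by omega)
        rw [hN] at *
        rw [pos_zero, pos_zero] at this
        omega

theorem deletion_mono {v w : SignedWord (n + 1)} (h : v ≤ w) : deletion n v ≤ deletion n w :=
  (le_iff_deletion.1 h).1

theorem weakMove_deletion {v w : SignedWord (n + 1)} (h : WeakMove v.1 w.1) :
    deletion n v = deletion n w ∨ WeakMove (deletion n v).1 (deletion n w).1 := by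
  rcases h with ⟨l, a, b, r, hab, hu, hv⟩ | ⟨a, r, ha, hu, hv⟩
  · by_cases ha : a.natAbs = n + 1
    · left; apply Subtype.ext
      simp [deletion, hu, hv, List.filter_append, List.filter_cons, ha]
    by_cases hb : b.natAbs = n + 1
    · left; apply Subtype.ext
      simp [deletion, hu, hv, List.filter_append, List.filter_cons, hb]
    · right; left
      refine ⟨l.filter (fun a => a.natAbs ≠ n + 1), a, b, r.filter (fun a => a.natAbs ≠ n + 1),
        hab, ?_, ?_⟩
      · simp [deletion, hu, List.filter_append, ha, hb]
      · simp [deletion, hv, List.filter_append, ha, hb]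
  · by_cases ha' : a.natAbs = n + 1
    · left; apply Subtype.ext
      simp [deletion, hu, hv, ha']
    · right; right
      refine ⟨a, r.filter (fun a => a.natAbs ≠ n + 1), ha, ?_, ?_⟩
      · simp [deletion, hu, ha']
      · simp [deletion, hv, ha']

theorem deletion_eq_or_covBy {v w : SignedWord (n + 1)} (h : v ⋖ w) :
    deletion n v = deletion n w ∨ deletion n v ⋖ deletion n w :=
  (weakMove_deletion (weakMove_of_covBy h)).imp id covBy_of_weakMove

/-- In a fibre the letters after `n + 1` form a final segment of one fixed linear order, and final
segments are nested. -/
theorem le_or_le_of_deletion_eq {v w : SignedWord (n + 1)} (h : deletion n v = deletion n w) :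
    v ≤ w ∨ w ≤ v := by
  by_contra hcon
  simp only [le_iff_deletion, h, le_refl, true_and, not_or] at hcon
  push Not at hcon
  obtain ⟨⟨x, hx, h1, h2⟩, ⟨y, hy, h3, h4⟩⟩ := hcon
  have e1 := pos_deletion_lt_iff v hx hy
  have e2 := pos_deletion_lt_iff w hx hy
  rw [h] at e1
  omega

/-! ### Appending `±(n + 1)` -/

/-- Append a letter `±(n + 1)`. -/
def snoc (w : SignedWord n) (a : ℤ) (ha : a.natAbs = n + 1) : SignedWord (n + 1) :=
  ⟨w.1 ++ [a], by
    rw [List.map_append, List.range'_1_concat]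
    refine w.2.append (List.Perm.of_eq ?_)
    simp [ha, Nat.add_comm]⟩

theorem deletion_snoc (w : SignedWord n) (a : ℤ) (ha : a.natAbs = n + 1) :
    deletion n (w.snoc a ha) = w := by
  apply Subtype.ext
  simp only [deletion, snoc, List.filter_append]
  rw [List.filter_eq_self.2]
  · simp [ha]
  · intro x hx
    have := w.mem_bounds hx
    simp only [decide_eq_true_eq]
    omega

theorem snoc_covBy_snoc_iff {v w : SignedWord n} (a : ℤ) (ha : a.natAbs = n + 1) :
    v.snoc a ha ⋖ w.snoc a ha ↔ v ⋖ w := by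
  constructor
  · intro h
    rcases deletion_eq_or_covBy h with e | e
    · rw [deletion_snoc, deletion_snoc] at e
      exact absurd (by rw [e]) h.ne
    · rwa [deletion_snoc, deletion_snoc] at e
  · intro h
    apply covBy_of_weakMove
    rcases weakMove_of_covBy h with ⟨l, x, y, r, hab, hu, hv⟩ | ⟨x, r, hx, hu, hv⟩
    · exact Or.inl ⟨l, x, y, r ++ [a], hab, by simp [snoc, hu], by simp [snoc, hv]⟩
    · exact Or.inr ⟨x, r ++ [a], hx, by simp [snoc, hu], by simp [snoc, hv]⟩

theorem natAbs_pos_le (w : SignedWord n) (x : ℤ) : (w.pos x).natAbs ≤ n := by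
  have key : ∀ (l : List ℤ) (k : ℤ), AbsNodup l → 1 ≤ k → ∀ x ∈ l,
      signedPos k l x ≤ k + l.length - 1 := by
    intro l
    induction l with
    | nil => simp
    | cons a l ih =>
      intro k hl hk x hx
      obtain ⟨h0, h1, h2⟩ := hl.of_cons
      rw [List.length_cons]
      rcases List.mem_cons.1 hx with rfl | hx'
      · rw [signedPos_cons_self k hl]; push_cast; omega
      · rw [signedPos_cons_ne k (fun e => h1 (e ▸ natAbs_mem_map_of_mem hx'))]
        have := ih (k + 1) h0 (by omega) x hx'
        push_cast; omega
  have key' : ∀ x ∈ w.1, w.pos x ≤ n := by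
    intro x hx
    have := key w.1 1 w.absNodup le_rfl x hx
    rw [w.length_eq] at this
    rw [pos]; omega
  rcases lt_trichotomy (w.pos x) 0 with h | h | h
  · have := key' _ (w.pos_neg_iff.1 h)
    rw [pos_neg] at this
    omega
  · omega
  · have := key' _ (w.pos_pos_iff.1 h)
    omega

theorem pos_snoc_self (w : SignedWord n) (a : ℤ) (ha : a.natAbs = n + 1) :
    (w.snoc a ha).pos a = n + 1 := by
  have h1 : a.natAbs ∉ w.1.map Int.natAbs := by
    intro h
    rw [w.2.mem_iff, List.mem_range'_1] at h
    omega
  have h2 : a ≠ -a := by omega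
  simp only [pos, snoc, signedPos_append, signedPos_eq_zero _ _ _ h1, w.length_eq]
  simp [signedPos, h2, add_comm]

theorem pos_lt_of_natAbs_le (w : SignedWord (n + 1)) {x a : ℤ} (hx : x.natAbs ≤ n)
    (ha : a.natAbs = n + 1) (h : w.pos a = n + 1) : w.pos x < n + 1 := by
  have h1 := w.natAbs_pos_le x
  have h2 : w.pos x ≠ n + 1 := fun e => by
    have := w.pos_inj (by omega) (by omega) (e.trans h.symm)
    omega
  omega

/-- With `n + 1` at the end no letter follows it, so every bit is `0`. Dually, `-(n + 1)` at the end
puts `n + 1` at the start of the full word and makes every bit `1`. -/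
theorem isLeast_snoc (q : SignedWord n) :
    IsLeast (deletion n ⁻¹' {q}) (q.snoc (n + 1) (by omega)) := by
  refine ⟨deletion_snoc _ _ _, fun v hv => ?_⟩
  have hv' : deletion n v = q := hv
  rw [le_iff_deletion, deletion_snoc, hv']
  refine ⟨le_rfl, fun x hx h => ?_⟩
  have h1 := q.pos_snoc_self (n + 1) (by omega)
  have := pos_lt_of_natAbs_le _ hx (by omega) h1
  omega

theorem isGreatest_snoc (q : SignedWord n) :
    IsGreatest (deletion n ⁻¹' {q}) (q.snoc (-(n + 1)) (by omega)) := by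
  refine ⟨deletion_snoc _ _ _, fun v hv => ?_⟩
  have hv' : deletion n v = q := hv
  rw [le_iff_deletion, deletion_snoc, hv']
  refine ⟨le_rfl, fun x hx _ => ?_⟩
  have h1 := q.pos_snoc_self (-(n + 1)) (by omega)
  have := pos_lt_of_natAbs_le _ (x := -x) (by simpa using hx) (by omega) h1
  rw [pos_neg] at this h1
  omega

theorem isCylindricalProjection_deletion (n : ℕ) : IsCylindricalProjection (deletion n) := by
  refine ⟨fun v w h => deletion_eq_or_covBy h, fun q => ⟨?_, ?_⟩,
    fun q => q.snoc (n + 1) (by omega), fun q => q.snoc (-(n + 1)) (by omega),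
    isLeast_snoc, isGreatest_snoc, fun q q' => ⟨snoc_covBy_snoc_iff _ _, snoc_covBy_snoc_iff _ _⟩⟩
  · intro v hv w hw _
    exact le_or_le_of_deletion_eq (hv.trans hw.symm)
  · refine ⟨_, (isLeast_snoc q).1, _, (isGreatest_snoc q).1, fun h => ?_⟩
    have h1 := q.pos_snoc_self (n + 1) (by omega)
    have h2 := q.pos_snoc_self (-(n + 1)) (by omega)
    rw [pos_neg, ← h, h1] at h2
    omega

/-! ### Words from position functions -/

/-- The word lists the letters of positive `f`-value in increasing order of `f`; oddness gives one
letter of each absolute value and extends the comparison to the left half. -/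
theorem exists_pos_lt_iff (f : ℤ → ℤ) (hodd : ∀ x, f (-x) = -f x)
    (hinj : ∀ x y : ℤ, x.natAbs ≤ n → y.natAbs ≤ n → f x = f y → x = y) :
    ∃ w : SignedWord n, ∀ x y : ℤ, x.natAbs ≤ n → y.natAbs ≤ n →
      (w.pos x < w.pos y ↔ f x < f y) := by
  set s : Finset ℤ := (Finset.Icc (-(n : ℤ)) n).filter (fun x => 0 < f x) with hs
  have hsmem : ∀ x, x ∈ s ↔ x.natAbs ≤ n ∧ 0 < f x := by
    intro x
    simp only [hs, Finset.mem_filter, Finset.mem_Icc]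
    omega
  set l : List ℤ := s.toList.mergeSort (fun a b => decide (f a ≤ f b)) with hl
  have hmem : ∀ x, x ∈ l ↔ x.natAbs ≤ n ∧ 0 < f x := by
    intro x
    rw [hl, List.mem_mergeSort, Finset.mem_toList, hsmem]
  have hnd : l.Nodup := (List.mergeSort_perm _ _).nodup_iff.2 s.nodup_toList
  have hsorted : l.Pairwise (fun a b => f a < f b) := by
    have h1 : l.Pairwise (fun a b => f a ≤ f b) := by
      have := List.pairwise_mergeSort (le := fun a b => decide (f a ≤ f b))
        (by simp only [decide_eq_true_eq]; exact fun a b c => le_trans)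
        (by simp only [Bool.or_eq_true, decide_eq_true_eq]; exact fun a b => le_total _ _) s.toList
      simpa using this
    refine (h1.and hnd).imp_of_mem fun {a b} ha hb h => lt_of_le_of_ne h.1 fun e => h.2 ?_
    exact hinj a b ((hmem a).1 ha).1 ((hmem b).1 hb).1 e
  have h0 : f 0 = 0 := by have := hodd 0; rw [neg_zero] at this; omega
  have hperm : (l.map Int.natAbs).Perm (List.range' 1 n) := by
    rw [List.perm_ext_iff_of_nodup _ List.nodup_range']
    · intro k
      rw [List.mem_map, List.mem_range'_1]
      constructor
      · rintro ⟨x, hx, rfl⟩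
        have := (hmem x).1 hx
        have : x ≠ 0 := by rintro rfl; omega
        omega
      · rintro ⟨hk1, hk2⟩
        rcases lt_trichotomy (f k) 0 with h | h | h
        · exact ⟨-k, (hmem _).2 ⟨by omega, by rw [hodd]; omega⟩, by omega⟩
        · have := hinj k 0 (by omega) (by omega) (h.trans h0.symm)
          omega
        · exact ⟨k, (hmem _).2 ⟨by omega, h⟩, by omega⟩
    · refine List.Nodup.map_on ?_ hnd
      intro x hx y hy hxy
      rcases Int.natAbs_eq_natAbs_iff.1 hxy with h | h
      · exact h
      · have h1 := (hmem x).1 hx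
        have h2 := (hmem y).1 hy
        rw [h, hodd] at h1
        omega
  refine ⟨⟨l, hperm⟩, ?_⟩
  set w : SignedWord n := ⟨l, hperm⟩ with hw
  have h1 : ∀ x : ℤ, x.natAbs ≤ n → 0 < w.pos x → 0 < f x := by
    intro x hx h
    exact ((hmem x).1 (w.pos_pos_iff.1 h)).2
  have h2 : ∀ x y : ℤ, x.natAbs ≤ n → y.natAbs ≤ n → w.pos x < w.pos y → f x < f y := by
    intro x y hx hy h
    refine lt_of_lt_of_odd (pos_neg w) hodd ?_ h1 ?_ hx hy h
    · intro x hx h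
      by_contra hne
      exact pos_ne_zero _ hne hx h
    · intro x y hx hy h h'
      have : Precedes w.1 x y := w.precedes_iff.2 ⟨h, h'⟩
      exact List.pairwise_iff_forall_sublist.1 hsorted this
  intro x y hx hy
  refine ⟨h2 x y hx hy, fun h => ?_⟩
  rcases lt_trichotomy (w.pos x) (w.pos y) with h' | h' | h'
  · exact h'
  · rw [w.pos_inj hx hy h'] at h
    exact absurd h (lt_irrefl _)
  · exact absurd h (lt_asymm (h2 y x hy hx h'))

end SignedWord

/-! ### Binary numbers -/

theorem sum_mul_two_pow_lt {f : ℕ → ℕ} (hf : ∀ j, f j ≤ 1) (m : ℕ) :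
    ∑ j ∈ Finset.range m, f j * 2 ^ j < 2 ^ m := by
  induction m with
  | zero => simp
  | succ m ih =>
    rw [Finset.sum_range_succ, pow_succ]
    have := Nat.mul_le_mul_right (2 ^ m) (hf m)
    omega

/-- The gain at digit `k` is at least `2 ^ k`, while the lower digits of `f` together are worth less
than that. -/
theorem sum_mul_two_pow_lt_sum {f g : ℕ → ℕ} (hf : ∀ j, f j ≤ 1) {m k : ℕ} (hk : k < m)
    (hfg : f k < g k) (h : ∀ j < m, k < j → f j ≤ g j) :
    ∑ j ∈ Finset.range m, f j * 2 ^ j < ∑ j ∈ Finset.range m, g j * 2 ^ j := by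
  induction m with
  | zero => omega
  | succ m ih =>
    rw [Finset.sum_range_succ, Finset.sum_range_succ]
    rcases Nat.lt_succ_iff_lt_or_eq.1 hk with hk' | rfl
    · have h1 := ih hk' (fun j hj => h j (by omega))
      have h2 := Nat.mul_le_mul_right (2 ^ m) (h m (by omega) hk')
      omega
    · have h1 := sum_mul_two_pow_lt hf k
      have h2 := Nat.mul_le_mul_right (2 ^ k) (Nat.succ_le_of_lt hfg)
      rw [Nat.succ_mul] at h2
      omega

theorem exists_top_of_sum_lt {f g : ℕ → ℕ} (hg : ∀ j, g j ≤ 1) {m : ℕ}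
    (h : ∑ j ∈ Finset.range m, f j * 2 ^ j < ∑ j ∈ Finset.range m, g j * 2 ^ j) :
    ∃ k < m, f k < g k ∧ ∀ j < m, k < j → f j = g j := by
  induction m with
  | zero => simp at h
  | succ m ih =>
    rcases lt_trichotomy (f m) (g m) with h1 | h1 | h1
    · exact ⟨m, by omega, h1, fun j _ _ => by omega⟩
    · rw [Finset.sum_range_succ, Finset.sum_range_succ, h1] at h
      obtain ⟨k, hk, hk1, hk2⟩ := ih (by omega)
      refine ⟨k, by omega, hk1, fun j hj hkj => ?_⟩
      rcases Nat.lt_succ_iff_lt_or_eq.1 hj with hj | rfl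
      · exact hk2 j hj hkj
      · exact h1
    · exact absurd h (lt_asymm (sum_mul_two_pow_lt_sum hg (by omega : m < m + 1) h1
        (fun j _ _ => by omega)))

theorem eq_of_sum_mul_two_pow_eq {f g : ℕ → ℕ} (hf : ∀ j, f j ≤ 1) (hg : ∀ j, g j ≤ 1) {m : ℕ}
    (h : ∑ j ∈ Finset.range m, f j * 2 ^ j = ∑ j ∈ Finset.range m, g j * 2 ^ j) :
    ∀ j < m, f j = g j := by
  induction m with
  | zero => simp
  | succ m ih =>
    have hm : f m = g m := by
      rcases lt_trichotomy (f m) (g m) with h1 | h1 | h1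
      · exact absurd h (sum_mul_two_pow_lt_sum hf (by omega : m < m + 1) h1
          (fun j _ _ => by omega)).ne
      · exact h1
      · exact absurd h (sum_mul_two_pow_lt_sum hg (by omega : m < m + 1) h1
          (fun j _ _ => by omega)).ne'
    rw [Finset.sum_range_succ, Finset.sum_range_succ, hm] at h
    intro j hj
    rcases Nat.lt_succ_iff_lt_or_eq.1 hj with hj | rfl
    · exact ih (by omega) j hj
    · exact hm

/-- The number with binary digits `x n, …, x (-n)`, the most significant digit first. -/
def binaryValue (n : ℕ) (x : ℤ → ℕ) : ℕ :=
  ∑ j ∈ Finset.range (2 * n + 1), x ((j : ℤ) - n) * 2 ^ j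

theorem binaryValue_lt {n : ℕ} {x y : ℤ → ℕ} (hx : ∀ a, x a ≤ 1) {k : ℤ} (hk : k.natAbs ≤ n)
    (hxy : x k < y k) (h : ∀ a : ℤ, a.natAbs ≤ n → k < a → x a ≤ y a) :
    binaryValue n x < binaryValue n y := by
  refine sum_mul_two_pow_lt_sum (fun j => hx _) (k := (k + n).toNat) (by omega) ?_ ?_
  · have : (((k + n).toNat : ℕ) : ℤ) - n = k := by omega
    rwa [this]
  · intro j hj hkj
    exact h _ (by omega) (by omega)

theorem exists_top_of_binaryValue_lt {n : ℕ} {x y : ℤ → ℕ} (hy : ∀ a, y a ≤ 1)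
    (h : binaryValue n x < binaryValue n y) :
    ∃ k : ℤ, k.natAbs ≤ n ∧ x k < y k ∧ ∀ a : ℤ, a.natAbs ≤ n → k < a → x a = y a := by
  obtain ⟨k, hk, h1, h2⟩ := exists_top_of_sum_lt (fun j => hy _) h
  refine ⟨(k : ℤ) - n, by omega, h1, fun a ha hka => ?_⟩
  have := h2 (a + n).toNat (by omega) (by omega)
  rwa [show (((a + n).toNat : ℕ) : ℤ) - n = a by omega] at this

theorem eq_of_binaryValue_eq {n : ℕ} {x y : ℤ → ℕ} (hx : ∀ a, x a ≤ 1) (hy : ∀ a, y a ≤ 1)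
    (h : binaryValue n x = binaryValue n y) (a : ℤ) (ha : a.natAbs ≤ n) : x a = y a := by
  have := eq_of_sum_mul_two_pow_eq (fun j => hx _) (fun j => hy _) h (a + n).toNat (by omega)
  rwa [show (((a + n).toNat : ℕ) : ℤ) - n = a by omega] at this

theorem binaryValue_mono {n : ℕ} {x y : ℤ → ℕ} (h : ∀ a : ℤ, a.natAbs ≤ n → x a ≤ y a) :
    binaryValue n x ≤ binaryValue n y := by
  refine Finset.sum_le_sum fun j hj => Nat.mul_le_mul_right _ (h _ ?_)
  rw [Finset.mem_range] at hj
  omega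

theorem binaryValue_congr {n : ℕ} {x y : ℤ → ℕ} (h : ∀ a : ℤ, a.natAbs ≤ n → x a = y a) :
    binaryValue n x = binaryValue n y :=
  le_antisymm (binaryValue_mono fun a ha => (h a ha).le)
    (binaryValue_mono fun a ha => (h a ha).ge)

/-- The two sums and the middle term are the stretches of exponents below, above and equal to `n`:
the digit at `a` always has weight `2 ^ (n + a)`. -/
theorem binaryValue_eq_sum (n : ℕ) (x : ℤ → ℕ) :
    ∑ i ∈ Finset.Icc 1 n, x (-(i : ℤ)) * 2 ^ (n - i) + x 0 * 2 ^ n +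
      ∑ i ∈ Finset.Icc 1 n, x (i : ℤ) * 2 ^ (n + i) = binaryValue n x := by
  have h1 : ∑ i ∈ Finset.Icc 1 n, x (-(i : ℤ)) * 2 ^ (n - i) =
      ∑ j ∈ Finset.range n, x ((j : ℤ) - n) * 2 ^ j := by
    refine Finset.sum_nbij' (fun i => n - i) (fun j => n - j) ?_ ?_ ?_ ?_ ?_
    · intro i hi; rw [Finset.mem_Icc] at hi; rw [Finset.mem_range]; omega
    · intro i hi; rw [Finset.mem_range] at hi; rw [Finset.mem_Icc]; omega
    · intro i hi; rw [Finset.mem_Icc] at hi; omega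
    · intro i hi; rw [Finset.mem_range] at hi; omega
    · intro i hi
      rw [Finset.mem_Icc] at hi
      rw [show (((n - i : ℕ) : ℤ) - n) = -i by omega]
  have h2 : ∑ i ∈ Finset.Icc 1 n, x (i : ℤ) * 2 ^ (n + i) =
      ∑ j ∈ Finset.range n, x (((n + 1 + j : ℕ) : ℤ) - n) * 2 ^ (n + 1 + j) := by
    refine Finset.sum_nbij' (fun i => i - 1) (fun j => j + 1) ?_ ?_ ?_ ?_ ?_
    · intro i hi; rw [Finset.mem_Icc] at hi; rw [Finset.mem_range]; omega
    · intro i hi; rw [Finset.mem_range] at hi; rw [Finset.mem_Icc]; omega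
    · intro i hi; rw [Finset.mem_Icc] at hi; omega
    · intro i hi; rw [Finset.mem_range] at hi; omega
    · intro i hi
      rw [Finset.mem_Icc] at hi
      rw [show (((n + 1 + (i - 1) : ℕ) : ℤ) - n) = i by omega,
        show n + 1 + (i - 1) = n + i by omega]
  rw [h1, h2, binaryValue, show 2 * n + 1 = n + 1 + n by omega, Finset.sum_range_add,
    Finset.sum_range_succ]
  simp

/-! ### The bits of a word, its valuation and its inversions. -/

namespace SignedWord

variable {n : ℕ}

/-- The indicator of `n + 1` occurring before `x` in the full word. -/
def bit (w : SignedWord (n + 1)) (x : ℤ) : ℕ := if w.pos (n + 1) < w.pos x then 1 else 0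

theorem bit_le_one (w : SignedWord (n + 1)) (x : ℤ) : w.bit x ≤ 1 := by
  unfold bit; split_ifs <;> omega

theorem bit_eq_one_iff (w : SignedWord (n + 1)) (x : ℤ) :
    w.bit x = 1 ↔ w.pos (n + 1) < w.pos x := by
  unfold bit; split_ifs <;> simp_all

theorem bit_eq_zero_iff (w : SignedWord (n + 1)) (x : ℤ) :
    w.bit x = 0 ↔ ¬ w.pos (n + 1) < w.pos x := by
  unfold bit; split_ifs <;> simp_all

/-- The number whose binary digits are the bits of `w`. -/
def value (w : SignedWord (n + 1)) : ℕ := binaryValue n w.bit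

theorem pos_last_ne_zero (w : SignedWord (n + 1)) : w.pos (n + 1) ≠ 0 :=
  w.pos_ne_zero (by omega) (by omega)

theorem pos_last_ne (w : SignedWord (n + 1)) {x : ℤ} (hx : x.natAbs ≤ n) :
    w.pos (n + 1) ≠ w.pos x ∧ w.pos (n + 1) ≠ - w.pos x := by
  constructor
  · intro h
    have := w.pos_inj (by omega) (by omega) h
    omega
  · rw [← pos_neg]
    intro h
    have := w.pos_inj (by omega) (by omega) h
    omega

/-- Of `±(n + 1)`, the one occurring in the word has the larger, positive position. Being to its
right is the same as exceeding both positions. -/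
theorem mem_wordData_snd (w : SignedWord (n + 1)) (a : ℤ) : a ∈ (wordData n w.1).2 ↔
    w.pos (n + 1) < w.pos a ∧ -w.pos (n + 1) < w.pos a := by
  have h0 := w.pos_last_ne_zero
  simp only [wordData, Finset.mem_filter, List.mem_toFinset, precedes_iff, pos_neg,
    ← pos_pos_iff w]
  omega

theorem wordData_fst_eq_neg_one (w : SignedWord (n + 1)) :
    (wordData n w.1).1 = -1 ↔ w.pos (n + 1) < 0 := by
  rw [pos_neg_iff]
  unfold wordData
  split_ifs with h
  · simpa using h
  · simpa using h

theorem bitOne_wordData (w : SignedWord (n + 1)) : bitOne (wordData n w.1) = w.bit 0 := by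
  simp only [bitOne, bit, wordData_fst_eq_neg_one, pos_zero]

/-- The second summand of `bitTwo` covers the letters between `n + 1` and `-(n + 1)`: they follow `n
+ 1` exactly when the sign is negative. -/
theorem bitTwo_wordData (w : SignedWord (n + 1)) {a : ℤ} (ha : a.natAbs ≤ n) :
    bitTwo (wordData n w.1) a = w.bit a := by
  have h0 := w.pos_last_ne_zero
  have h1 := w.pos_last_ne ha
  simp only [bitTwo, bit, wordData_fst_eq_neg_one, mem_wordData_snd, pos_neg]
  split_ifs <;> omega

theorem valuation_horizontalClass (w : SignedWord (n + 1)) :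
    valuation n (horizontalClass (deletion n) w) = w.value := by
  rw [value, ← binaryValue_eq_sum, ← bitOne_wordData]
  change pairValuation n (wordData n w.1) = _
  unfold pairValuation
  refine congrArg₂ (· + ·) (congrArg₂ (· + ·) ?_ rfl) ?_
  · refine Finset.sum_congr rfl fun i hi => ?_
    rw [Finset.mem_Icc] at hi
    rw [bitTwo_wordData _ (by omega)]
  · refine Finset.sum_congr rfl fun i hi => ?_
    rw [Finset.mem_Icc] at hi
    rw [bitTwo_wordData _ (by omega)]

/-- In the full word the four alternatives defining an inversion are the mirror-image forms of a
single condition, that `n + 1` stands before `±i`. -/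
theorem inversionValuation_eq (w : SignedWord (n + 1)) : inversionValuation n w = w.value := by
  have hcast : ((n + 1 : ℕ) : ℤ) = n + 1 := by push_cast; ring
  have h0 := w.pos_last_ne_zero
  have hcomp : ∀ i : ℕ, 1 ≤ i → i ≤ n → w.pos i ≠ 0 := fun i h1 h2 =>
    w.pos_ne_zero (by omega) (by omega)
  have hneg : InvSymbol.neg (n + 1) ∈ Inversions w ↔ w.pos (n + 1) < w.pos 0 := by
    change (1 ≤ n + 1 ∧ n + 1 ≤ n + 1 ∧ -((n + 1 : ℕ) : ℤ) ∈ w.1) ↔ _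
    rw [← pos_neg_iff, hcast, pos_zero]
    simp
  have hpn : ∀ i : ℕ, 1 ≤ i → i ≤ n → (InvSymbol.pairNeg (n + 1) i ∈ Inversions w ↔
      w.pos (n + 1) < w.pos (-i)) := by
    intro i hi hi'
    have h1 := w.pos_last_ne (x := i) (by omega)
    have h2 := hcomp i hi hi'
    change (1 ≤ i ∧ i < n + 1 ∧ n + 1 ≤ n + 1 ∧ (_ ∨ _ ∨ _ ∨ _)) ↔ _
    simp only [precedes_iff, hcast, pos_neg]
    omega
  have hpp : ∀ i : ℕ, 1 ≤ i → i ≤ n → (InvSymbol.pairPos (n + 1) i ∈ Inversions w ↔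
      w.pos (n + 1) < w.pos i) := by
    intro i hi hi'
    have h1 := w.pos_last_ne (x := i) (by omega)
    have h2 := hcomp i hi hi'
    change (1 ≤ i ∧ i < n + 1 ∧ n + 1 ≤ n + 1 ∧ (_ ∨ _ ∨ _ ∨ _)) ↔ _
    simp only [precedes_iff, hcast, pos_neg]
    omega
  rw [value, ← binaryValue_eq_sum]
  unfold inversionValuation bit
  refine congrArg₂ (· + ·) (congrArg₂ (· + ·) ?_ ?_) ?_
  · refine Finset.sum_congr rfl fun i hi => ?_
    rw [Finset.mem_Icc] at hi
    simp only [hpn i hi.1 hi.2]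
  · simp only [hneg]
  · refine Finset.sum_congr rfl fun i hi => ?_
    rw [Finset.mem_Icc] at hi
    simp only [hpp i hi.1 hi.2]

/-! ### The value and the weak order -/

theorem bit_mono {v w : SignedWord (n + 1)} (h : v ≤ w) {x : ℤ} (hx : x.natAbs ≤ n) :
    v.bit x ≤ w.bit x := by
  have := (le_iff_deletion.1 h).2 x hx
  unfold bit
  split_ifs <;> simp_all

theorem value_mono {v w : SignedWord (n + 1)} (h : v ≤ w) : v.value ≤ w.value :=
  binaryValue_mono fun _ hx => bit_mono h hx

theorem value_eq_iff {v w : SignedWord (n + 1)} :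
    v.value = w.value ↔ ∀ x : ℤ, x.natAbs ≤ n → v.bit x = w.bit x :=
  ⟨fun h x hx => eq_of_binaryValue_eq v.bit_le_one w.bit_le_one h x hx, binaryValue_congr⟩

theorem eq_of_deletion_eq_of_value_eq {v w : SignedWord (n + 1)}
    (h : deletion n v = deletion n w) (h' : v.value = w.value) : v = w := by
  rw [value_eq_iff] at h'
  refine le_antisymm (le_iff_deletion.2 ⟨h.le, fun x hx => ?_⟩)
    (le_iff_deletion.2 ⟨h.ge, fun x hx => ?_⟩)
  · rw [← bit_eq_one_iff, ← bit_eq_one_iff, h' x hx]; exact id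
  · rw [← bit_eq_one_iff, ← bit_eq_one_iff, h' x hx]; exact id

/-- If `w` is below `v` after deletion, but not below `v` by its new inversions, then the value
of `w` is larger. -/
theorem value_lt_of_not_le {v w : SignedWord (n + 1)} (h : deletion n w ≤ deletion n v)
    (hn : ¬ w ≤ v) : v.value < w.value := by
  rw [le_iff_deletion, not_and] at hn
  have hn' := hn h
  push Not at hn'
  obtain ⟨x, hx, h1, h2⟩ := hn'
  refine binaryValue_lt v.bit_le_one hx ?_ fun y hy hxy => ?_
  · rw [(bit_eq_zero_iff v x).2 (by omega), (bit_eq_one_iff w x).2 h1]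
    omega
  -- Let `y > x` have bit `1` in `v`. Then `x`, `n + 1`, `y` occur in this order in `v`, so `(x, y)`
  -- is not inverted in `v`, hence not in `w`. Since `n + 1` precedes `x` in `w`, it also precedes
  -- `y`. Above `x` the bits of `v` are thus at most those of `w`.
  · have h3 := le_iff_pos.1 h x y hx hy hxy
    rw [pos_deletion_lt_iff _ hy hx, pos_deletion_lt_iff _ hy hx] at h3
    have h4 := fun e => (bit_eq_one_iff w y).2 e
    have h5 := (bit_eq_zero_iff v y).2
    have h6 := v.bit_le_one y
    have h7 : v.pos x ≠ v.pos y := fun e => hxy.ne (v.pos_inj (by omega) (by omega) e)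
    have h8 : w.pos x ≠ w.pos y := fun e => hxy.ne (w.pos_inj (by omega) (by omega) e)
    by_cases c : v.pos (n + 1) < v.pos y
    · rw [(bit_eq_one_iff w y).2 (by omega)]
      exact h6
    · rw [h5 c]; omega

end SignedWord

/-! ### Valid bit sequences and the grades of letters. -/

/-- The bit sequences that occur for signed words: for a word with the letter `n + 1`, opposite
bits are not both `1`; for a word with the letter `-(n + 1)`, they are not both `0`. -/
structure IsValidBits (n : ℕ) (x : ℤ → ℕ) : Prop where
  le_one : ∀ a, x a ≤ 1
  add_le : x 0 = 0 → ∀ a : ℤ, a.natAbs ≤ n → x a + x (-a) ≤ 1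
  le_add : x 0 = 1 → ∀ a : ℤ, a.natAbs ≤ n → 1 ≤ x a + x (-a)

/-- The sign of the letter `a` if `±a` lies to the right of `±(n + 1)`, and `0` otherwise. -/
def letterGrade (x : ℤ → ℕ) (a : ℤ) : ℤ := x a - x (-a)

theorem letterGrade_neg (x : ℤ → ℕ) (a : ℤ) : letterGrade x (-a) = -letterGrade x a := by
  simp [letterGrade]

namespace SignedWord

variable {n : ℕ}

/-- If `n + 1` lies in the right half, it cannot precede both of `a` and `-a`; if it lies in the
left half, it precedes at least one of them. -/
theorem isValidBits_bit (w : SignedWord (n + 1)) : IsValidBits n w.bit where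
  le_one := w.bit_le_one
  add_le h a ha := by
    have h0 := w.pos_last_ne_zero
    have h1 := w.pos_last_ne ha
    rw [bit_eq_zero_iff, pos_zero] at h
    simp only [bit, pos_neg]
    split_ifs <;> omega
  le_add h a ha := by
    have h0 := w.pos_last_ne_zero
    have h1 := w.pos_last_ne ha
    rw [bit_eq_one_iff, pos_zero] at h
    simp only [bit, pos_neg]
    split_ifs <;> omega

/-- Every valid bit sequence occurs; the words with `s = 1` and `s = -1` are the smallest and the
largest words in its class. -/
theorem exists_bit_eq {x : ℤ → ℕ} (hx : IsValidBits n x) {s : ℤ} (hs : s = 1 ∨ s = -1) :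
    ∃ w : SignedWord (n + 1), (∀ a : ℤ, a.natAbs ≤ n → w.bit a = x a) ∧
      ∀ a b : ℤ, a.natAbs ≤ n → b.natAbs ≤ n → a < b →
        (w.pos b < w.pos a ↔ letterGrade x b < letterGrade x a ∨ letterGrade x b = letterGrade x a ∧ s = -1) := by
  set e : ℤ := (1 - 2 * x 0) * (n + 1) with he
  have he' : (x 0 = 0 ∧ e = n + 1) ∨ (x 0 = 1 ∧ e = -(n + 1)) := by
    have := hx.le_one 0
    rcases (by omega : x 0 = 0 ∨ x 0 = 1) with h | h
    · exact Or.inl ⟨h, by rw [he, h]; push_cast; ring⟩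
    · exact Or.inr ⟨h, by rw [he, h]; push_cast; ring⟩
  -- The letters `±(n + 1)` get the values `±e`, of absolute value `n + 1`. Letters of grade `0` get
  -- absolute value at most `n` and fall between them. The factor `2 * n + 3` pushes grades `±1` to
  -- absolute value at least `n + 3`, outside them. The term `s * a` orders each block, increasingly
  -- for `s = 1` and decreasingly for `s = -1`.
  set f : ℤ → ℤ := fun a => if a = n + 1 then e else if a = -(n + 1) then -e else
    (2 * n + 3) * letterGrade x a + s * a with hf
  have hf1 : f (n + 1) = e := by simp [hf]
  have hf2 : f (-(n + 1)) = -e := by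
    simp only [hf]; rw [if_neg (by omega)]; simp
  have hf3 : ∀ a : ℤ, a ≠ n + 1 → a ≠ -(n + 1) → f a = (2 * n + 3) * letterGrade x a + s * a :=
    fun a h1 h2 => by simp only [hf]; rw [if_neg h1, if_neg h2]
  have hodd : ∀ a, f (-a) = - f a := by
    intro a
    by_cases h1 : a = n + 1
    · rw [h1, hf1, hf2]
    · by_cases h2 : a = -(n + 1)
      · rw [h2, hf2, neg_neg, hf1, neg_neg]
      · rw [hf3 a h1 h2, hf3 (-a) (by omega) (by omega), letterGrade_neg]; ring
  have hfs : ∀ a : ℤ, a.natAbs ≤ n →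
      (letterGrade x a = -1 ∧ f a = -(2 * n + 3) + s * a) ∨ (letterGrade x a = 0 ∧ f a = s * a) ∨
      (letterGrade x a = 1 ∧ f a = 2 * n + 3 + s * a) := by
    intro a ha
    rw [hf3 a (by omega) (by omega)]
    have h1 := hx.le_one a
    have h2 := hx.le_one (-a)
    rcases (by unfold letterGrade; omega : letterGrade x a = -1 ∨ letterGrade x a = 0 ∨ letterGrade x a = 1) with
      h | h | h <;> rw [h] <;> simp
  have hinj : ∀ a b : ℤ, a.natAbs ≤ n + 1 → b.natAbs ≤ n + 1 → f a = f b → a = b := by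
    have hcases : ∀ a : ℤ, a.natAbs ≤ n + 1 → a = n + 1 ∨ a = -(n + 1) ∨ a.natAbs ≤ n := by
      intro a ha; omega
    intro a b ha hb hab
    rcases hs with rfl | rfl <;>
    rcases hcases a ha with rfl | rfl | ha' <;> rcases hcases b hb with rfl | rfl | hb' <;>
    (try simp only [hf1, hf2] at hab) <;> try omega
    all_goals first
      | (have h1 := hfs a ha'; have h2 := hfs b hb'; omega)
      | (have h1 := hfs a ha'; omega)
      | (have h2 := hfs b hb'; omega)
  obtain ⟨w, hw⟩ := exists_pos_lt_iff (n := n + 1) f hodd hinj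
  refine ⟨w, fun a ha => ?_, fun a b ha hb hab => ?_⟩
  · have h1 := hw (n + 1) a (by omega) (by omega)
    have h2 := hfs a ha
    have h3 := hx.le_one a
    have h4 := hx.le_one (-a)
    have h5 := fun h => hx.add_le h a ha
    have h6 := fun h => hx.le_add h a ha
    rw [hf1] at h1
    unfold bit
    rw [if_congr h1 rfl rfl]
    unfold letterGrade at h2
    rcases hs with rfl | rfl <;> split_ifs <;> omega
  · rw [hw b a (by omega) (by omega)]
    have h1 := hfs a ha
    have h2 := hfs b hb
    rcases hs with rfl | rfl <;> omega

/-! ### Horizontal classes -/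

/-- The inversions of a word only involve letters whose grades are weakly decreasing. -/
theorem letterGrade_le_of_pos_lt (w : SignedWord (n + 1)) {a b : ℤ} (ha : a.natAbs ≤ n)
    (hb : b.natAbs ≤ n) (h : w.pos b < w.pos a) : letterGrade w.bit b ≤ letterGrade w.bit a := by
  have h0 := w.pos_last_ne_zero
  have h1 := w.pos_last_ne ha
  have h2 := w.pos_last_ne hb
  simp only [letterGrade, bit, pos_neg]
  split_ifs <;> omega

/-- The value is monotone, hence constant along a chain of moves from `v` to `w`. A vertical cover
would change it, so all these covers are horizontal. -/
theorem horizontalClass_eq_of_le {v w : SignedWord (n + 1)} (h : v ≤ w)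
    (hvw : v.value = w.value) :
    horizontalClass (deletion n) v = horizontalClass (deletion n) w := by
  have h' : ReflTransGen (fun x y : SignedWord (n + 1) => WeakMove x.1 y.1) v w := h
  induction h' with
  | refl => rfl
  | @tail b c hab hbc ih =>
    have hab' : v ≤ b := hab
    have hcov := covBy_of_weakMove hbc
    have h1 := value_mono hab'
    have h2 := value_mono hcov.le
    have h3 : b.value = c.value := by omega
    rw [ih hab (by omega)]
    apply Quotient.sound
    refine EqvGen.rel _ _ ⟨hcov, (deletion_eq_or_covBy hcov).resolve_left fun e => ?_⟩
    exact hcov.ne (eq_of_deletion_eq_of_value_eq e h3)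

theorem letterGrade_congr {x y : ℤ → ℕ} (h : ∀ a : ℤ, a.natAbs ≤ n → x a = y a) {a : ℤ}
    (ha : a.natAbs ≤ n) : letterGrade x a = letterGrade y a := by
  rw [letterGrade, letterGrade, h a ha, h (-a) (by simpa using ha)]

/-- Inverted pairs of `v` have weakly decreasing grades, and `u` inverts all such pairs, ties
included. The clause `(-1 : ℤ) = -1` is the tie-break `s = -1` of `exists_bit_eq` at that value of
`s`. -/
theorem le_of_largest {v u : SignedWord (n + 1)}
    (hu : ∀ a : ℤ, a.natAbs ≤ n → v.bit a = u.bit a)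
    (hinv : ∀ a b : ℤ, a.natAbs ≤ n → b.natAbs ≤ n → a < b →
      (u.pos b < u.pos a ↔ letterGrade u.bit b < letterGrade u.bit a ∨
        letterGrade u.bit b = letterGrade u.bit a ∧ (-1 : ℤ) = -1)) : v ≤ u := by
  rw [le_iff_deletion, le_iff_pos]
  refine ⟨fun a b ha hb hab => ?_, fun a ha => ?_⟩
  · rw [pos_deletion_lt_iff _ hb ha, pos_deletion_lt_iff _ hb ha, hinv a b ha hb hab]
    intro h
    have := v.letterGrade_le_of_pos_lt ha hb h
    rw [letterGrade_congr hu ha, letterGrade_congr hu hb] at this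
    rcases this.lt_or_eq with h' | h'
    · exact Or.inl h'
    · exact Or.inr ⟨h', rfl⟩
  · rw [← bit_eq_one_iff, ← bit_eq_one_iff, hu a ha]; exact id

/-- The largest and smallest words with the bits of `v`. -/
theorem exists_extremal (v : SignedWord (n + 1)) {s : ℤ} (hs : s = 1 ∨ s = -1) :
    ∃ u : SignedWord (n + 1), v.value = u.value ∧ ∀ a b : ℤ, a.natAbs ≤ n → b.natAbs ≤ n → a < b →
      (u.pos b < u.pos a ↔ letterGrade v.bit b < letterGrade v.bit a ∨
        letterGrade v.bit b = letterGrade v.bit a ∧ s = -1) := by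
  obtain ⟨u, hu, hinv⟩ := exists_bit_eq v.isValidBits_bit hs
  exact ⟨u, value_eq_iff.2 fun a ha => (hu a ha).symm, hinv⟩

/-- All words of one value lie below a common largest word of that value, and each is joined to it
by horizontal covers. -/
theorem horizontalClass_eq_iff {v w : SignedWord (n + 1)} :
    horizontalClass (deletion n) v = horizontalClass (deletion n) w ↔ v.value = w.value := by
  constructor
  · intro h
    rw [← valuation_horizontalClass, ← valuation_horizontalClass, h]
  · intro h
    obtain ⟨u, hu, hinv⟩ := v.exists_extremal (Or.inr rfl)
    have hle : ∀ v' : SignedWord (n + 1), v'.value = v.value → v' ≤ u := by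
      intro v' hv'
      have h1 := value_eq_iff.1 (hv'.trans hu)
      refine le_of_largest h1 fun a b ha hb hab => ?_
      rw [hinv a b ha hb hab, letterGrade_congr (value_eq_iff.1 hu) ha,
        letterGrade_congr (value_eq_iff.1 hu) hb]
    rw [horizontalClass_eq_of_le (hle v rfl) hu,
      horizontalClass_eq_of_le (hle w h.symm) (h.symm.trans hu)]

/-! ### Edges and paths -/

theorem valuation_lt_of_adj {x y : HorizontalClass (deletion n)}
    (h : (augmentedPreReebGraph (deletion n)).Adj x y) : valuation n x < valuation n y := by
  rcases h with ⟨v, w, rfl, rfl, hcov, heq⟩ | ⟨v, w, rfl, rfl, hlt, h1, h2⟩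
  · rw [valuation_horizontalClass, valuation_horizontalClass]
    exact (value_mono hcov.le).lt_of_ne fun e => hcov.ne (eq_of_deletion_eq_of_value_eq heq e)
  · rw [valuation_horizontalClass, valuation_horizontalClass]
    exact value_lt_of_not_le hlt.le h2

/-- Deletion is monotone, so a chain of covers between two words of one fibre never leaves it, and
all its covers are vertical. -/
theorem reaches_of_le {v w : SignedWord (n + 1)} (h : v ≤ w)
    (heq : deletion n v = deletion n w) :
    ReflTransGen (augmentedPreReebGraph (deletion n)).Adj (horizontalClass (deletion n) v)
      (horizontalClass (deletion n) w) := by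
  have h' : ReflTransGen (fun x y : SignedWord (n + 1) => WeakMove x.1 y.1) v w := h
  induction h' with
  | refl => exact .refl
  | @tail b c hab hbc ih =>
    have hcov := covBy_of_weakMove hbc
    have h1 : deletion n v ≤ deletion n b := deletion_mono hab
    have h2 := deletion_mono hcov.le
    have h3 : deletion n v = deletion n b := le_antisymm h1 (heq ▸ h2)
    exact (ih hab h3).tail (Or.inl ⟨b, c, rfl, rfl, hcov, h3.symm.trans heq⟩)

/-- In one fibre the words are comparable and vertical covers suffice. Otherwise `v` and `w` are
incomparable: the values exclude `w ≤ v` and the deletions exclude `v ≤ w`. A single auxiliary edge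
then joins the classes. -/
theorem reaches_of_deletion_le {v w : SignedWord (n + 1)} (h : v.value < w.value)
    (hle : deletion n w ≤ deletion n v) :
    ReflTransGen (augmentedPreReebGraph (deletion n)).Adj (horizontalClass (deletion n) v)
      (horizontalClass (deletion n) w) := by
  have hn : ¬ w ≤ v := fun e => (value_mono e).not_gt h
  by_cases heq : deletion n w = deletion n v
  · exact reaches_of_le ((le_or_le_of_deletion_eq heq).resolve_left hn) heq.symm
  · refine .single (Or.inr ⟨v, w, rfl, rfl, hle.lt_of_ne heq, fun e => ?_, hn⟩)
    exact heq (le_antisymm hle (deletion_mono e))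

end SignedWord

/-! ### Consecutive bit sequences -/

theorem IsValidBits.update {n : ℕ} {x : ℤ → ℕ} (hx : IsValidBits n x) {j : ℤ} {c : ℕ}
    (hc : c ≤ 1) (hj : j ≠ 0) (h0 : x 0 = 0 → c + x (-j) ≤ 1) (h1 : x 0 = 1 → 1 ≤ c + x (-j)) :
    IsValidBits n (Function.update x j c) := by
  have hz : Function.update x j c 0 = x 0 := Function.update_of_ne hj.symm _ _
  refine ⟨fun a => ?_, fun h a ha => ?_, fun h a ha => ?_⟩
  · by_cases h : a = j
    · subst h; simpa using hc
    · rw [Function.update_of_ne h]; exact hx.le_one a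
  all_goals
    rw [hz] at h
    by_cases e1 : a = j
    · subst e1
      rw [Function.update_self, Function.update_of_ne (by omega)]
      first | exact h0 h | exact h1 h
    · by_cases e2 : -a = j
      · subst e2
        rw [Function.update_self, Function.update_of_ne e1, add_comm]
        rw [neg_neg] at h0 h1
        first | exact h0 h | exact h1 h
      · rw [Function.update_of_ne e1, Function.update_of_ne e2]
        first | exact hx.add_le h a ha | exact hx.le_add h a ha

theorem IsValidBits.update_zero_one {n : ℕ} {x : ℤ → ℕ} (hx : IsValidBits n x)
    (h : ∀ a : ℤ, a.natAbs ≤ n → a ≠ 0 → 1 ≤ x a + x (-a)) :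
    IsValidBits n (Function.update x 0 1) := by
  refine ⟨fun a => ?_, fun h' => by simp at h', fun _ a ha => ?_⟩
  · by_cases e : a = 0
    · subst e; simp
    · rw [Function.update_of_ne e]; exact hx.le_one a
  · by_cases e : a = 0
    · subst e; simp
    · rw [Function.update_of_ne e, Function.update_of_ne (by omega)]; exact h a ha e

theorem IsValidBits.update_zero_zero {n : ℕ} {x : ℤ → ℕ} (hx : IsValidBits n x)
    (h : ∀ a : ℤ, a.natAbs ≤ n → a ≠ 0 → x a + x (-a) ≤ 1) :
    IsValidBits n (Function.update x 0 0) := by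
  refine ⟨fun a => ?_, fun _ a ha => ?_, fun h' => by simp at h'⟩
  · by_cases e : a = 0
    · subst e; simp
    · rw [Function.update_of_ne e]; exact hx.le_one a
  · by_cases e : a = 0
    · subst e; simp
    · rw [Function.update_of_ne e, Function.update_of_ne (by omega)]; exact h a ha e

/-- The shape of two consecutive valid bit sequences `x` and `y` whose top difference is at `k`. -/
structure IsConsecutiveAt (n : ℕ) (x y : ℤ → ℕ) (k : ℤ) : Prop where
  left_valid : IsValidBits n x
  right_valid : IsValidBits n y
  left_top : x k = 0
  right_top : y k = 1
  eq_above : ∀ c : ℤ, c.natAbs ≤ n → k < c → x c = y c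
  left_zero : 0 < k → x 0 = 1
  right_zero : 0 < k → y 0 = 0
  left_below : ∀ c : ℤ, c.natAbs ≤ n → c < k → c ≠ 0 → x c = 0 → x 0 = 0 ∧ x (-c) = 1
  right_below : ∀ c : ℤ, c.natAbs ≤ n → c < k → c ≠ 0 → y c = 1 → y 0 = 1 ∧ y (-c) = 0

/-- Raising a digit of `x` below the top difference, or lowering one of `y`, gives a number strictly
between the two. Each such change must therefore violate validity, which pins down the lower digits.
-/
theorem exists_isConsecutiveAt {n : ℕ} {x y : ℤ → ℕ} (hx : IsValidBits n x)
    (hy : IsValidBits n y) (hlt : binaryValue n x < binaryValue n y)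
    (hbtw : ∀ z, IsValidBits n z → binaryValue n x < binaryValue n z →
      ¬ binaryValue n z < binaryValue n y) :
    ∃ k : ℤ, k.natAbs ≤ n ∧ IsConsecutiveAt n x y k := by
  obtain ⟨k, hk, hxy, htop⟩ := exists_top_of_binaryValue_lt hy.le_one hlt
  have hxk : x k = 0 := by have := hy.le_one k; omega
  have hyk : y k = 1 := by have := hy.le_one k; omega
  have hup : ∀ j : ℤ, j.natAbs ≤ n → j < k → x j = 0 →
      ¬ IsValidBits n (Function.update x j 1) := by
    intro j hj hjk hxj hz
    refine hbtw _ hz (binaryValue_lt hx.le_one hj (by simp [hxj]) fun i hi hji => ?_)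
      (binaryValue_lt hz.le_one hk ?_ fun i hi hki => ?_)
    · rw [Function.update_of_ne hji.ne']
    · rw [Function.update_of_ne hjk.ne']; omega
    · rw [Function.update_of_ne (by omega), htop i hi hki]
  have hdown : ∀ j : ℤ, j.natAbs ≤ n → j < k → y j = 1 →
      ¬ IsValidBits n (Function.update y j 0) := by
    intro j hj hjk hyj hz
    refine hbtw _ hz (binaryValue_lt hx.le_one hk ?_ fun i hi hki => ?_)
      (binaryValue_lt hz.le_one hj (by simp [hyj]) fun i hi hji => ?_)
    · rw [Function.update_of_ne hjk.ne']; omega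
    · rw [Function.update_of_ne (by omega), htop i hi hki]
    · rw [Function.update_of_ne hji.ne']
  have hup' : ∀ j : ℤ, j.natAbs ≤ n → j < k → j ≠ 0 → x j = 0 → x 0 = 0 ∧ x (-j) = 1 := by
    intro j hj hjk hj0 hxj
    by_contra hcon
    refine hup j hj hjk hxj (hx.update le_rfl hj0 (fun h0 => ?_) (fun _ => by omega))
    have := hx.le_one (-j)
    omega
  have hdown' : ∀ j : ℤ, j.natAbs ≤ n → j < k → j ≠ 0 → y j = 1 → y 0 = 1 ∧ y (-j) = 0 := by
    intro j hj hjk hj0 hyj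
    by_contra hcon
    refine hdown j hj hjk hyj (hy.update (by omega) hj0 (fun _ => ?_) (fun h0 => ?_))
    · have := hy.le_one (-j)
      omega
    · have := hy.le_one (-j)
      omega
  -- For `k > 0` the negative member of every pair `±a` lies below `k`, so its digit in `x` is `0`
  -- only when the opposite digit is `1`. Hence no pair has two digits `0`, and a sign bit `0` could
  -- be raised. The argument for `y` is dual.
  have hx0 : 0 < k → x 0 = 1 := by
    intro hk0
    by_contra hne
    have h0 : x 0 = 0 := by have := hx.le_one 0; omega
    refine hup 0 (by simp) hk0 h0 (hx.update_zero_one fun a ha ha0 => ?_)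
    rcases lt_or_gt_of_ne ha0 with hneg | hpos
    · by_contra hcon
      have := hup' a ha (by omega) ha0 (by omega)
      omega
    · by_contra hcon
      have := hup' (-a) (by simpa using ha) (by omega) (by omega) (by omega)
      rw [neg_neg] at this
      omega
  have hy0 : 0 < k → y 0 = 0 := by
    intro hk0
    by_contra hne
    have h0 : y 0 = 1 := by have := hy.le_one 0; omega
    refine hdown 0 (by simp) hk0 h0 (hy.update_zero_zero fun a ha ha0 => ?_)
    have l1 := hy.le_one a
    have l2 := hy.le_one (-a)
    rcases lt_or_gt_of_ne ha0 with hneg | hpos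
    · by_contra hcon
      have := hdown' a ha (by omega) ha0 (by omega)
      omega
    · by_contra hcon
      have := hdown' (-a) (by simpa using ha) (by omega) (by omega) (by omega)
      rw [neg_neg] at this
      omega
  exact ⟨k, hk, hx, hy, hxk, hyk, htop, hx0, hy0, hup', hdown'⟩

namespace IsConsecutiveAt

variable {n : ℕ} {x y : ℤ → ℕ} {k : ℤ}

/-- For `|c| < |k|` both digits at `±c` lie above the top difference and agree. For `|c| > |k|`
exactly one of `±c` lies below `k`; there `x` has the complement of the opposite digit and `y` has
`0`. -/
theorem letterGrade_of_neg_of_zero (h : IsConsecutiveAt n x y k) (hk : k < 0) (h0 : x 0 = 0)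
    {c : ℤ} (hc : c.natAbs ≤ n) :
    (k < c ∧ c < -k ∧ letterGrade x c = letterGrade y c) ∨
    (c = -k ∧ letterGrade x c = 0 ∧ letterGrade y c = -1) ∨
    (c = k ∧ letterGrade x c = 0 ∧ letterGrade y c = 1) ∨
    (-k < c ∧ letterGrade x c = 1 ∧ letterGrade y c = 1) ∨
    (-k < c ∧ letterGrade x c = -1 ∧ letterGrade y c = 0) ∨
    (c < k ∧ letterGrade x c = -1 ∧ letterGrade y c = -1) ∨
    (c < k ∧ letterGrade x c = 1 ∧ letterGrade y c = 0) := by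
  have hy0 : y 0 = 0 := by rw [← h.eq_above 0 (by simp) hk, h0]
  have e1 : ∀ c : ℤ, c.natAbs ≤ n → c < k → x c + x (-c) = 1 ∧ y c = 0 ∧ x (-c) = y (-c) := by
    intro c hc hck
    have a1 := h.left_valid.add_le h0 c hc
    have a2 := h.left_below c hc hck (by omega)
    have a3 := h.right_below c hc hck (by omega)
    have a4 := h.right_valid.le_one c
    have a5 := h.eq_above (-c) (by simpa using hc) (by omega)
    omega
  have e2 := h.eq_above c hc
  have hc' : (-c).natAbs ≤ n := by simpa using hc
  have e3 := h.eq_above (-c) hc'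
  have e4 := h.left_top
  have e5 := h.right_top
  unfold letterGrade
  rcases lt_trichotomy c k with hck | hck | hck
  · have := e1 c hc hck
    clear e1 e2 e3
    by_cases hv : letterGrade x c = -1
    · unfold letterGrade at hv
      right; right; right; right; right; left; omega
    · unfold letterGrade at hv
      right; right; right; right; right; right; omega
  · subst hck
    have := h.right_valid.add_le hy0 c hc
    clear e1
    right; right; left; omega
  · rcases lt_trichotomy c (-k) with hck' | hck' | hck'
    · clear e1
      left; omega
    · obtain rfl : k = -c := by omega
      have := h.right_valid.add_le hy0 c hc
      clear e1
      right; left; omega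
    · have := e1 (-c) hc' (by omega)
      rw [neg_neg] at this
      clear e1 e2 e3
      by_cases hv : x c = 1
      · right; right; right; left; omega
      · right; right; right; right; left; omega

/-- Dual to the case of sign bit `0`: below `k` the digits of `x` are all `1`, and those of `y` are
the complements of the opposite digits. -/
theorem letterGrade_of_neg_of_one (h : IsConsecutiveAt n x y k) (hk : k < 0) (h0 : x 0 = 1)
    {c : ℤ} (hc : c.natAbs ≤ n) :
    (k < c ∧ c < -k ∧ letterGrade x c = letterGrade y c) ∨
    (c = -k ∧ letterGrade x c = 1 ∧ letterGrade y c = 0) ∨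
    (c = k ∧ letterGrade x c = -1 ∧ letterGrade y c = 0) ∨
    (-k < c ∧ letterGrade x c = 0 ∧ letterGrade y c = 1) ∨
    (-k < c ∧ letterGrade x c = -1 ∧ letterGrade y c = -1) ∨
    (c < k ∧ letterGrade x c = 0 ∧ letterGrade y c = -1) ∨
    (c < k ∧ letterGrade x c = 1 ∧ letterGrade y c = 1) := by
  have hy0 : y 0 = 1 := by rw [← h.eq_above 0 (by simp) hk, h0]
  have e1 : ∀ c : ℤ, c.natAbs ≤ n → c < k →
      y c + y (-c) = 1 ∧ x c = 1 ∧ x (-c) = y (-c) ∧ y c ≤ 1 := by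
    intro c hc hck
    have a1 := h.right_valid.le_add hy0 c hc
    have a2 := h.left_below c hc hck (by omega)
    have a3 := h.right_below c hc hck (by omega)
    have a4 := h.right_valid.le_one c
    have a5 := h.eq_above (-c) (by simpa using hc) (by omega)
    have a6 := h.left_valid.le_one c
    have a7 := h.right_valid.le_one (-c)
    omega
  have e2 := h.eq_above c hc
  have hc' : (-c).natAbs ≤ n := by simpa using hc
  have e3 := h.eq_above (-c) hc'
  have e4 := h.left_top
  have e5 := h.right_top
  have e6 := h.left_valid.le_one c
  have e7 := h.left_valid.le_one (-c)
  unfold letterGrade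
  rcases lt_trichotomy c k with hck | hck | hck
  · have := e1 c hc hck
    clear e1 e2 e3
    by_cases hv : letterGrade x c = 0
    · unfold letterGrade at hv
      right; right; right; right; right; left; omega
    · unfold letterGrade at hv
      right; right; right; right; right; right; omega
  · subst hck
    have := h.left_valid.le_add h0 c hc
    clear e1
    right; right; left; omega
  · rcases lt_trichotomy c (-k) with hck' | hck' | hck'
    · clear e1
      left; omega
    · obtain rfl : k = -c := by omega
      have := h.left_valid.le_add h0 c hc
      clear e1
      right; left; omega
    · have := e1 (-c) hc' (by omega)
      rw [neg_neg] at this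
      clear e1 e2 e3
      by_cases hv : x c = 1
      · right; right; right; left; omega
      · right; right; right; right; left; omega

/-- Opposite digits at nonzero letters are complementary in both sequences, and the positive digits
agree. Only the sign of `±(n + 1)` changes, with no nonzero letter of grade `0` in between. -/
theorem letterGrade_of_zero (h : IsConsecutiveAt n x y 0) {c : ℤ} (hc : c.natAbs ≤ n) :
    letterGrade x c = letterGrade y c := by
  have main : ∀ c : ℤ, c.natAbs ≤ n → c < 0 → x c = y c ∧ x (-c) = y (-c) := by
    intro c hc hc0
    have a1 := h.left_valid.add_le h.left_top c hc
    have a2 := h.right_valid.le_add h.right_top c hc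
    have a3 := h.left_below c hc hc0 (by omega)
    have a4 := h.right_below c hc hc0 (by omega)
    have a5 := h.eq_above (-c) (by simpa using hc) (by omega)
    have a6 := h.right_valid.le_one c
    have a7 := h.right_valid.le_one (-c)
    omega
  unfold letterGrade
  rcases lt_trichotomy c 0 with h0 | rfl | h0
  · rw [(main c hc h0).1, (main c hc h0).2]
  · simp
  · have := main (-c) (by simpa using hc) (by omega)
    rw [neg_neg] at this
    rw [this.1, this.2]

/-- Below `k` all digits of `x` are `1` and all those of `y` are `0`, so passing from `x` to `y`
raises the grade by `1` at letters above `k` and by `2` at `k`, with the opposite changes at the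
opposite letters. -/
theorem letterGrade_of_pos (h : IsConsecutiveAt n x y k) (hk : 0 < k) {c : ℤ}
    (hc : c.natAbs ≤ n) :
    (-k < c ∧ c < k ∧ letterGrade x c = 0 ∧ letterGrade y c = 0) ∨
    (c = -k ∧ letterGrade x c = 1 ∧ letterGrade y c = -1) ∨
    (c = k ∧ letterGrade x c = -1 ∧ letterGrade y c = 1) ∨
    (k < c ∧ letterGrade x c = 0 ∧ letterGrade y c = 1) ∨
    (k < c ∧ letterGrade x c = -1 ∧ letterGrade y c = 0) ∨
    (c < -k ∧ letterGrade x c = 0 ∧ letterGrade y c = -1) ∨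
    (c < -k ∧ letterGrade x c = 1 ∧ letterGrade y c = 0) := by
  have hx0 := h.left_zero hk
  have hy0 := h.right_zero hk
  have e1 : ∀ c : ℤ, c.natAbs ≤ n → c < k → x c = 1 ∧ y c = 0 := by
    intro c hc hck
    by_cases hc0 : c = 0
    · rw [hc0]; exact ⟨hx0, hy0⟩
    · have a1 := h.left_below c hc hck hc0
      have a2 := h.right_below c hc hck hc0
      have a3 := h.left_valid.le_one c
      have a4 := h.right_valid.le_one c
      omega
  have e2 := h.eq_above c hc
  have hc' : (-c).natAbs ≤ n := by simpa using hc
  have e3 := h.eq_above (-c) hc'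
  have e4 := h.left_top
  have e5 := h.right_top
  have e6 := h.left_valid.le_one c
  have e7 := h.left_valid.le_one (-c)
  have e8 := e1 c hc
  have e9 := e1 (-c) hc'
  unfold letterGrade
  rcases lt_trichotomy c k with hck | hck | hck
  · rcases lt_trichotomy c (-k) with hck' | hck' | hck'
    · clear e1 e2
      by_cases hv : x (-c) = 1
      · right; right; right; right; right; left; omega
      · right; right; right; right; right; right; omega
    · obtain rfl : k = -c := by omega
      clear e1 e2 e3
      right; left; omega
    · clear e1 e2 e3
      left; omega
  · subst hck
    clear e1 e2 e3
    right; right; left; omega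
  · clear e1
    by_cases hv : x c = 1
    · right; right; right; left; omega
    · right; right; right; right; left; omega

end IsConsecutiveAt

/-- If no valid sequence lies strictly between `x` and `y`, then the grades of `x` and `y` never
order two letters in strictly opposite ways, with the smaller letter first for `x`. -/
theorem letterGrade_compatible_of_consecutive {n : ℕ} {x y : ℤ → ℕ} (hx : IsValidBits n x)
    (hy : IsValidBits n y) (hlt : binaryValue n x < binaryValue n y)
    (hbtw : ∀ z, IsValidBits n z → binaryValue n x < binaryValue n z →
      ¬ binaryValue n z < binaryValue n y)
    {a b : ℤ} (ha : a.natAbs ≤ n) (hb : b.natAbs ≤ n) (hab : a < b)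
    (h : letterGrade x a < letterGrade x b) : letterGrade y a ≤ letterGrade y b := by
  obtain ⟨k, hk, hcon⟩ := exists_isConsecutiveAt hx hy hlt hbtw
  rcases lt_trichotomy k 0 with hk0 | rfl | hk0
  · rcases (by have := hx.le_one 0; omega : x 0 = 0 ∨ x 0 = 1) with h0 | h0
    · have m1 := hcon.letterGrade_of_neg_of_zero hk0 h0 ha
      have m2 := hcon.letterGrade_of_neg_of_zero hk0 h0 hb
      rcases m1 with m | m | m | m | m | m | m <;> omega
    · have m1 := hcon.letterGrade_of_neg_of_one hk0 h0 ha
      have m2 := hcon.letterGrade_of_neg_of_one hk0 h0 hb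
      rcases m1 with m | m | m | m | m | m | m <;> omega
  · rw [← hcon.letterGrade_of_zero ha, ← hcon.letterGrade_of_zero hb]
    exact h.le
  · have m1 := hcon.letterGrade_of_pos hk0 ha
    have m2 := hcon.letterGrade_of_pos hk0 hb
    rcases m1 with m | m | m | m | m | m | m <;> omega

/-! ### Paths between classes, acyclicity and reachability. -/

namespace SignedWord

variable {n : ℕ}

/-- Consecutive values are joined by a path. -/
theorem reaches_of_consecutive {v w : SignedWord (n + 1)} (h : v.value < w.value)
    (hbtw : ∀ u : SignedWord (n + 1), v.value < u.value → ¬ u.value < w.value) :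
    ReflTransGen (augmentedPreReebGraph (deletion n)).Adj (horizontalClass (deletion n) v)
      (horizontalClass (deletion n) w) := by
  -- The largest word of the lower class also inverts ties of grade, while the smallest word of the
  -- upper class inverts only strict descents. It remains to see that a strict descent for `w` is a
  -- weak descent for `v`.
  obtain ⟨v', hv, hinv⟩ := v.exists_extremal (s := -1) (Or.inr rfl)
  obtain ⟨w', hw, hinw⟩ := w.exists_extremal (s := 1) (Or.inl rfl)
  rw [horizontalClass_eq_iff.2 hv, horizontalClass_eq_iff.2 hw]
  apply reaches_of_deletion_le (hv ▸ hw ▸ h)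
  rw [le_iff_pos]
  intro a b ha hb hab
  rw [pos_deletion_lt_iff _ hb ha, pos_deletion_lt_iff _ hb ha, hinv a b ha hb hab,
    hinw a b ha hb hab]
  have := letterGrade_compatible_of_consecutive v.isValidBits_bit w.isValidBits_bit h
    (fun z hz h1 h2 => by
      obtain ⟨u, hu, -⟩ := exists_bit_eq hz (s := 1) (Or.inl rfl)
      have hu' : u.value = binaryValue n z := binaryValue_congr hu
      exact hbtw u (hu' ▸ h1) (hu' ▸ h2)) ha hb hab
  omega

/-- Only finitely many values lie between the two, so splitting at intermediate values reduces to
consecutive ones. -/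
theorem reaches_of_value_le {v w : SignedWord (n + 1)} (h : v.value ≤ w.value) :
    ReflTransGen (augmentedPreReebGraph (deletion n)).Adj (horizontalClass (deletion n) v)
      (horizontalClass (deletion n) w) := by
  induction hk : w.value - v.value using Nat.strong_induction_on generalizing v w with
  | _ k ih =>
    rcases h.eq_or_lt with h | h
    · rw [horizontalClass_eq_iff.2 h]
    · by_cases hbtw : ∃ u : SignedWord (n + 1), v.value < u.value ∧ u.value < w.value
      · obtain ⟨u, h1, h2⟩ := hbtw
        exact (ih _ (by omega) h1.le rfl).trans (ih _ (by omega) h2.le rfl)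
      · push Not at hbtw
        exact reaches_of_consecutive h fun u h1 => (hbtw u h1).not_gt

theorem reaches_iff {x y : HorizontalClass (deletion n)} :
    ReflTransGen (augmentedPreReebGraph (deletion n)).Adj x y ↔
      valuation n x ≤ valuation n y := by
  constructor
  · intro h
    induction h with
    | refl => exact le_rfl
    | tail _ hbc ih => exact ih.trans (valuation_lt_of_adj hbc).le
  · induction x using Quotient.inductionOn with | _ v
    induction y using Quotient.inductionOn with | _ w
    intro h
    have h' : valuation n (horizontalClass (deletion n) v) ≤
      valuation n (horizontalClass (deletion n) w) := h
    rw [valuation_horizontalClass, valuation_horizontalClass] at h'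
    exact reaches_of_value_le h'

theorem isAcyclicDigraph_augmentedPreReebGraph (n : ℕ) :
    IsAcyclicDigraph (augmentedPreReebGraph (deletion n)) := by
  have key : ∀ x y, TransGen (augmentedPreReebGraph (deletion n)).Adj x y →
      valuation n x < valuation n y := by
    intro x y h
    induction h with
    | single h => exact valuation_lt_of_adj h
    | tail _ h ih => exact ih.trans (valuation_lt_of_adj h)
  exact fun x h => lt_irrefl _ (key x x h)

/-! ### The number of horizontal classes -/

/-- The bits determined by the sign of the letter `±(n + 1)` and by the grades of `1, …, n`
(shifted by `1`). -/
def bitsOfData (n : ℕ) (d : Bool × (Fin n → Fin 3)) (a : ℤ) : ℕ :=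
  let g : ℤ := if h : 1 ≤ a.natAbs ∧ a.natAbs ≤ n then
    a.sign * ((d.2 ⟨a.natAbs - 1, by omega⟩ : ℕ) - 1) else 0
  -- With a negative sign `n + 1` stands before the block of grade `0`; with a positive sign it
  -- stands after it, and only grade `1` follows.
  if d.1 then (if 0 ≤ g then 1 else 0) else (if g = 1 then 1 else 0)

theorem bitsOfData_zero (d : Bool × (Fin n → Fin 3)) :
    bitsOfData n d 0 = if d.1 then 1 else 0 := by
  simp [bitsOfData]

theorem bitsOfData_pos (d : Bool × (Fin n → Fin 3)) (i : Fin n) :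
    bitsOfData n d ((i : ℤ) + 1) =
      if d.1 then (if 1 ≤ (d.2 i : ℕ) then 1 else 0) else (if (d.2 i : ℕ) = 2 then 1 else 0) := by
  have h : 1 ≤ ((i : ℤ) + 1).natAbs ∧ ((i : ℤ) + 1).natAbs ≤ n := by omega
  have hi : (⟨((i : ℤ) + 1).natAbs - 1, by omega⟩ : Fin n) = i := by ext; simp only; omega
  have hs : ((i : ℤ) + 1).sign = 1 := Int.sign_eq_one_of_pos (by omega)
  simp only [bitsOfData, dif_pos h, hi, hs]
  split_ifs <;> omega

theorem bitsOfData_neg (d : Bool × (Fin n → Fin 3)) (i : Fin n) :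
    bitsOfData n d (-((i : ℤ) + 1)) =
      if d.1 then (if (d.2 i : ℕ) ≤ 1 then 1 else 0) else (if (d.2 i : ℕ) = 0 then 1 else 0) := by
  have h : 1 ≤ (-((i : ℤ) + 1)).natAbs ∧ (-((i : ℤ) + 1)).natAbs ≤ n := by omega
  have hi : (⟨(-((i : ℤ) + 1)).natAbs - 1, by omega⟩ : Fin n) = i := by ext; simp only; omega
  have hs : (-((i : ℤ) + 1)).sign = -1 := Int.sign_eq_neg_one_of_neg (by omega)
  simp only [bitsOfData, dif_pos h, hi, hs]
  split_ifs <;> omega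

theorem bitsOfData_le_one (d : Bool × (Fin n → Fin 3)) (a : ℤ) : bitsOfData n d a ≤ 1 := by
  simp only [bitsOfData]
  split_ifs <;> omega

theorem eq_zero_or_exists_fin {a : ℤ} (ha : a.natAbs ≤ n) :
    a = 0 ∨ ∃ i : Fin n, a = (i : ℤ) + 1 ∨ a = -((i : ℤ) + 1) := by
  by_cases h : a = 0
  · exact Or.inl h
  · exact Or.inr ⟨⟨a.natAbs - 1, by omega⟩, by simp only; omega⟩

theorem isValidBits_bitsOfData (d : Bool × (Fin n → Fin 3)) :
    IsValidBits n (bitsOfData n d) := by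
  refine ⟨bitsOfData_le_one d, fun h a ha => ?_, fun h a ha => ?_⟩ <;>
  rw [bitsOfData_zero] at h <;>
  rcases eq_zero_or_exists_fin ha with rfl | ⟨i, rfl | rfl⟩ <;>
  simp only [neg_zero, neg_neg, bitsOfData_zero, bitsOfData_pos, bitsOfData_neg] <;>
  split_ifs at * <;> omega

/-- Classes correspond to valid bit sequences. Once the sign is fixed, each pair of opposite digits
has three admissible values, recorded by the grade. -/
theorem card_horizontalClass (n : ℕ) :
    Nat.card (HorizontalClass (deletion n)) = 2 * 3 ^ n := by
  choose W hW _ using fun d : Bool × (Fin n → Fin 3) =>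
    exists_bit_eq (isValidBits_bitsOfData d) (s := 1) (Or.inl rfl)
  have hbij : Function.Bijective (fun d => horizontalClass (deletion n) (W d)) := by
    constructor
    · intro d d' h
      have h1 : ∀ a : ℤ, a.natAbs ≤ n → bitsOfData n d a = bitsOfData n d' a := by
        intro a ha
        rw [← hW d a ha, ← hW d' a ha]
        exact value_eq_iff.1 (horizontalClass_eq_iff.1 h) a ha
      have h2 : d.1 = d'.1 := by
        have := h1 0 (by simp)
        rw [bitsOfData_zero, bitsOfData_zero] at this
        cases hd : d.1 <;> cases hd' : d'.1 <;> simp_all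
      refine Prod.ext h2 (funext fun i => ?_)
      have h3 := h1 ((i : ℤ) + 1) (by omega)
      have h4 := h1 (-((i : ℤ) + 1)) (by omega)
      rw [bitsOfData_pos, bitsOfData_pos, h2] at h3
      rw [bitsOfData_neg, bitsOfData_neg, h2] at h4
      apply Fin.ext
      have l1 := (d.2 i).isLt
      have l2 := (d'.2 i).isLt
      split_ifs at h3 h4 <;> omega
    · intro x
      induction x using Quotient.inductionOn with | _ w
      have hv := w.isValidBits_bit
      -- The grade shifted by `1`; adding before subtracting avoids truncation, since the subtracted
      -- bit is at most `1`.
      have hlt : ∀ i : Fin n, w.bit ((i : ℤ) + 1) + 1 - w.bit (-((i : ℤ) + 1)) < 3 := by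
        intro i
        have := w.bit_le_one ((i : ℤ) + 1)
        omega
      let d : Bool × (Fin n → Fin 3) := (decide (w.bit 0 = 1), fun i => ⟨_, hlt i⟩)
      have hd1 : d.1 = true ↔ w.bit 0 = 1 := by simp [d]
      have hd2 : ∀ i : Fin n, (d.2 i : ℕ) = w.bit ((i : ℤ) + 1) + 1 - w.bit (-((i : ℤ) + 1)) :=
        fun i => rfl
      refine ⟨d, horizontalClass_eq_iff.2 (value_eq_iff.2 fun a ha => ?_)⟩
      rw [hW d a ha]
      have l0 := w.bit_le_one 0
      rcases eq_zero_or_exists_fin ha with rfl | ⟨i, hi⟩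
      · rw [bitsOfData_zero, if_congr hd1 rfl rfl]
        split_ifs <;> omega
      · have l1 := w.bit_le_one ((i : ℤ) + 1)
        have l2 := w.bit_le_one (-((i : ℤ) + 1))
        have l3 := fun h => hv.add_le h ((i : ℤ) + 1) (by omega)
        have l4 := fun h => hv.le_add h ((i : ℤ) + 1) (by omega)
        have l5 := hd2 i
        rcases hi with rfl | rfl
        · rw [bitsOfData_pos, if_congr hd1 rfl rfl]
          split_ifs <;> omega
        · rw [bitsOfData_neg, if_congr hd1 rfl rfl]
          split_ifs <;> omega
  rw [← Nat.card_congr (Equiv.ofBijective _ hbij)]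
  simp

/-! ### Compatible realizations -/

/-- The last coordinate of a compatible order-embedding realization is a strictly increasing
function of the horizontal class. -/
theorem exists_height {d : ℕ} {cQ : SignedWord n → Fin d → ℝ}
    (hQ : IsOrderEmbeddingCubicRealization cQ) {cP : SignedWord (n + 1) → Fin (d + 1) → ℝ}
    (hP : IsOrderEmbeddingCubicRealization cP) (hc : IsCompatibleLift (deletion n) cQ cP) :
    ∃ h : HorizontalClass (deletion n) → ℝ,
      (∀ x y, valuation n x < valuation n y → h x < h y) ∧
      ∀ w, cP w = Fin.snoc (cQ (deletion n w)) (h (horizontalClass (deletion n) w)) := by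
  obtain ⟨h, hh⟩ := hc
  have hlast : ∀ w, cP w (Fin.last d) = h w := fun w => by rw [hh]; simp
  have hinit : ∀ w (i : Fin d), cP w i.castSucc = cQ (deletion n w) i := fun w i => by
    rw [hh]; simp
  -- Along a horizontal cover the projected point moves, by injectivity of `cQ`. The only coordinate
  -- that changes is therefore an old one.
  have hhor : ∀ v w, HorizontalCover (deletion n) v w → h v = h w := by
    intro v w hvw
    obtain ⟨i, hi, hj⟩ := hP.1.2 v w hvw.1
    by_contra hne
    have hil : i = Fin.last d := by
      by_contra hi'
      exact hne (by rw [← hlast, ← hlast, hj _ (Ne.symm hi')])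
    subst hil
    apply hvw.2.ne
    apply hQ.1.1
    funext k
    rw [← hinit, ← hinit]
    exact hj _ (Fin.castSucc_lt_last k).ne
  let H : HorizontalClass (deletion n) → ℝ := Quotient.lift h (by
    intro v w hvw
    have hvw' : EqvGen (HorizontalCover (deletion n)) v w := hvw
    induction hvw' with
    | rel v w h => exact hhor v w h
    | refl => rfl
    | symm u v h ih => exact (ih h).symm
    | trans u v w h₁ h₂ ih₁ ih₂ => exact (ih₁ h₁).trans (ih₂ h₂))
  have hH : ∀ w, H (horizontalClass (deletion n) w) = h w := fun w => rfl
  have hadj : ∀ x y, (augmentedPreReebGraph (deletion n)).Adj x y → H x < H y := by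
    rintro x y (⟨v, w, rfl, rfl, hcov, heq⟩ | ⟨v, w, rfl, rfl, hlt, h1, h2⟩)
    · rw [hH, hH]
      obtain ⟨i, hi, hj⟩ := hP.1.2 v w hcov
      induction i using Fin.lastCases with
      | last => rwa [hlast, hlast] at hi
      | cast i =>
        rw [hinit, hinit, heq] at hi
        exact absurd hi (lt_irrefl _)
    · rw [hH, hH]
      -- If the height did not increase along the auxiliary edge, all coordinates of `w` would be at
      -- most those of `v`, and the order embedding would give `w ≤ v`.
      by_contra hcon
      apply h2
      rw [hP.2]
      intro i
      induction i using Fin.lastCases with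
      | last => rw [hlast, hlast]; exact not_lt.1 hcon
      | cast i => rw [hinit, hinit]; exact (hQ.2 _ _).1 hlt.le i
  refine ⟨H, fun x y hxy => ?_, fun w => by rw [hh, hH]⟩
  have hpath := reaches_iff.2 hxy.le
  rcases reflTransGen_iff_eq_or_transGen.1 hpath with rfl | hpath
  · exact absurd hxy (lt_irrefl _)
  · clear hxy
    induction hpath with
    | single h => exact hadj _ _ h
    | tail hab hbc ih => exact (ih hab.to_reflTransGen).trans (hadj _ _ hbc)

/-- A height strictly increasing in the value tests the order together with the deletion, by
`value_mono` and `value_lt_of_not_le`. Vertical covers change only the height; horizontal covers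
stay in one class and change only a coordinate of `cQ`. -/
theorem isOrderEmbedding_of_height {d : ℕ} {cQ : SignedWord n → Fin d → ℝ}
    (hQ : IsOrderEmbeddingCubicRealization cQ) {cP : SignedWord (n + 1) → Fin (d + 1) → ℝ}
    {h : HorizontalClass (deletion n) → ℝ}
    (hmono : ∀ x y, valuation n x < valuation n y → h x < h y)
    (hP : ∀ w, cP w = Fin.snoc (cQ (deletion n w)) (h (horizontalClass (deletion n) w))) :
    IsOrderEmbeddingCubicRealization cP := by
  have hlast : ∀ w, cP w (Fin.last d) = h (horizontalClass (deletion n) w) := fun w => by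
    rw [hP]; simp
  have hinit : ∀ w (i : Fin d), cP w i.castSucc = cQ (deletion n w) i := fun w i => by
    rw [hP]; simp
  have hlt : ∀ v w : SignedWord (n + 1), v.value < w.value →
      h (horizontalClass (deletion n) v) < h (horizontalClass (deletion n) w) := by
    intro v w hvw
    apply hmono
    rwa [valuation_horizontalClass, valuation_horizontalClass]
  have horder : ∀ v w, v ≤ w ↔ ∀ i, cP v i ≤ cP w i := by
    intro v w
    constructor
    · intro hvw i
      induction i using Fin.lastCases with
      | last =>
        rw [hlast, hlast]
        rcases (value_mono hvw).eq_or_lt with e | e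
        · rw [horizontalClass_eq_iff.2 e]
        · exact (hlt _ _ e).le
      | cast i => rw [hinit, hinit]; exact (hQ.2 _ _).1 (deletion_mono hvw) i
    · intro hvw
      have h1 : deletion n v ≤ deletion n w := by
        rw [hQ.2]
        intro i
        rw [← hinit, ← hinit]
        exact hvw _
      by_contra hn
      have h2 := hlt _ _ (value_lt_of_not_le h1 hn)
      have h3 := hvw (Fin.last d)
      rw [hlast, hlast] at h3
      exact h2.not_ge h3
  refine ⟨⟨fun v w hvw => ?_, fun v w hvw => ?_⟩, horder⟩
  · exact le_antisymm ((horder v w).2 fun i => by rw [hvw]) ((horder w v).2 fun i => by rw [hvw])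
  · rcases deletion_eq_or_covBy hvw with e | e
    · refine ⟨Fin.last d, ?_, fun j hj => ?_⟩
      · rw [hlast, hlast]
        apply hlt
        exact (value_mono hvw.le).lt_of_ne fun e' =>
          hvw.ne (eq_of_deletion_eq_of_value_eq e e')
      · induction j using Fin.lastCases with
        | last => exact absurd rfl hj
        | cast j => rw [hinit, hinit, e]
    · obtain ⟨i, hi, hj⟩ := hQ.1.2 _ _ e
      refine ⟨i.castSucc, by rwa [hinit, hinit], fun j hj' => ?_⟩
      induction j using Fin.lastCases with
      | last =>
        rw [hlast, hlast]
        congr 1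
        exact Quotient.sound (EqvGen.rel _ _ ⟨hvw, e⟩)
      | cast j =>
        rw [hinit, hinit]
        exact hj j fun h => hj' (by rw [h])

theorem isOrderEmbedding_and_isCompatibleLift_iff {d : ℕ} {cQ : SignedWord n → Fin d → ℝ}
    (hQ : IsOrderEmbeddingCubicRealization cQ) (cP : SignedWord (n + 1) → Fin (d + 1) → ℝ) :
    (IsOrderEmbeddingCubicRealization cP ∧ IsCompatibleLift (deletion n) cQ cP) ↔
      ∃ h : HorizontalClass (deletion n) → ℝ,
        (∀ x y, valuation n x < valuation n y → h x < h y) ∧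
        ∀ w, cP w = Fin.snoc (cQ (deletion n w)) (h (horizontalClass (deletion n) w)) :=
  ⟨fun h => exists_height hQ h.1 h.2, fun ⟨_, h1, h2⟩ =>
    ⟨isOrderEmbedding_of_height hQ h1 h2, _, h2⟩⟩

/-! ### Towers -/

/-- The tower whose coordinates are the valuations. -/
noncomputable def valuationTower : (k : ℕ) → SignedWord k → Fin k → ℝ
  | 0, _ => Fin.elim0
  | k + 1, w => Fin.snoc (valuationTower k (deletion k w))
      (valuation k (horizontalClass (deletion k) w) : ℝ)

instance : Subsingleton (SignedWord 0) where
  allEq u v := by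
    apply Subtype.ext
    rw [List.length_eq_zero_iff.1 u.length_eq, List.length_eq_zero_iff.1 v.length_eq]

theorem isOrderEmbedding_valuationTower (k : ℕ) :
    IsOrderEmbeddingCubicRealization (valuationTower k) := by
  induction k with
  | zero =>
    refine ⟨⟨Function.injective_of_subsingleton _, fun x y h => ?_⟩, fun x y => ?_⟩
    · exact absurd (Subsingleton.elim x y) h.ne
    · exact ⟨fun _ i => i.elim0, fun _ => (Subsingleton.elim x y).le⟩
  | succ k ih =>
    exact isOrderEmbedding_of_height ih (h := fun x => (valuation k x : ℝ))
      (fun x y h => by exact_mod_cast h) (fun w => rfl)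

theorem isCompatibleTower_valuationTower (N : ℕ) : IsCompatibleTower N valuationTower :=
  ⟨fun k _ => isOrderEmbedding_valuationTower k, fun _ _ => ⟨_, fun _ => rfl⟩⟩

/-- Compatibility makes every coordinate but the last a coordinate of the deleted word, and the last
is ordered by the value, which does not depend on the tower. -/
theorem le_iff_of_isCompatibleTower {N : ℕ} {c c' : (k : ℕ) → SignedWord k → Fin k → ℝ}
    (hc : IsCompatibleTower N c) (hc' : IsCompatibleTower N c') {k : ℕ} (hk : k ≤ N)
    (x y : SignedWord k) (i : Fin k) : c k x i ≤ c k y i ↔ c' k x i ≤ c' k y i := by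
  induction k with
  | zero => exact i.elim0
  | succ k ih =>
    have key : ∀ {c : (k : ℕ) → SignedWord k → Fin k → ℝ}, IsCompatibleTower N c →
        (∀ (w : SignedWord (k + 1)) (i : Fin k),
          c (k + 1) w i.castSucc = c k (deletion k w) i) ∧
        ∀ v w : SignedWord (k + 1),
          c (k + 1) v (Fin.last k) ≤ c (k + 1) w (Fin.last k) ↔ v.value ≤ w.value := by
      intro c hc
      obtain ⟨h, hmono, hh⟩ := exists_height (hc.1 k (by omega)) (hc.1 (k + 1) hk)
        (hc.2 k (by omega))
      have hlt : ∀ v w : SignedWord (k + 1), v.value < w.value →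
          h (horizontalClass (deletion k) v) < h (horizontalClass (deletion k) w) := by
        intro v w hvw
        apply hmono
        rwa [valuation_horizontalClass, valuation_horizontalClass]
      refine ⟨fun w i => by rw [hh]; simp, fun v w => ?_⟩
      rw [hh, hh, Fin.snoc_last, Fin.snoc_last]
      constructor
      · intro h1
        by_contra h2
        exact (hlt w v (not_le.1 h2)).not_ge h1
      · intro h1
        rcases h1.eq_or_lt with e | e
        · rw [horizontalClass_eq_iff.2 e]
        · exact (hlt v w e).le
    induction i using Fin.lastCases with
    | last => rw [(key hc).2, (key hc').2]
    | cast i =>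
      rw [(key hc).1, (key hc).1, (key hc').1, (key hc').1]
      exact ih (by omega) _ _ i

end SignedWord

theorem corollary3p8 (n : ℕ) :
    IsCylindricalProjection (deletion n) ∧
    -- the valuation reads off the `(n+1)`-inversions of any representative
    (∀ w : SignedWord (n + 1),
      valuation n (horizontalClass (deletion n) w) = inversionValuation n w) ∧
    -- acyclicity; the reachability poset is the total order induced by the valuation
    (∃ hG : IsAcyclicDigraph (augmentedPreReebGraph (deletion n)),
      (∀ x y : HorizontalClass (deletion n),
        (reachabilityPoset _ hG).le x y ↔ valuation n x ≤ valuation n y) ∧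
      (∀ x y : HorizontalClass (deletion n),
        (reachabilityPoset _ hG).le x y ∨ (reachabilityPoset _ hG).le y x)) ∧
    -- the number of vertices
    Nat.card (HorizontalClass (deletion n)) = 2 * 3 ^ n ∧
    -- one-step uniqueness: the possible new coordinates are the functions on the vertices that are
    -- strictly increasing for the valuation
    (∀ (d : ℕ) (cQ : SignedWord n → Fin d → ℝ), IsOrderEmbeddingCubicRealization cQ →
      ∀ cP : SignedWord (n + 1) → Fin (d + 1) → ℝ,
        (IsOrderEmbeddingCubicRealization cP ∧ IsCompatibleLift (deletion n) cQ cP) ↔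
        ∃ h : HorizontalClass (deletion n) → ℝ,
          (∀ x y, valuation n x < valuation n y → h x < h y) ∧
          ∀ w, cP w = Fin.snoc (cQ (deletion n w)) (h (horizontalClass (deletion n) w))) ∧
    -- combinatorial uniqueness on the whole tower
    (∃ c, IsCompatibleTower (n + 1) c) ∧
    (∀ c c', IsCompatibleTower (n + 1) c → IsCompatibleTower (n + 1) c' →
      ∀ (x y : SignedWord (n + 1)) (i : Fin (n + 1)),
        c (n + 1) x i ≤ c (n + 1) y i ↔ c' (n + 1) x i ≤ c' (n + 1) y i) := by
  refine ⟨SignedWord.isCylindricalProjection_deletion n, fun w => ?_,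
    ⟨SignedWord.isAcyclicDigraph_augmentedPreReebGraph n,
      fun x y => SignedWord.reaches_iff, fun x y => ?_⟩,
    SignedWord.card_horizontalClass n,
    fun d cQ hQ cP => SignedWord.isOrderEmbedding_and_isCompatibleLift_iff hQ cP,
    ⟨_, SignedWord.isCompatibleTower_valuationTower (n + 1)⟩,
    fun c c' hc hc' x y i => SignedWord.le_iff_of_isCompatibleTower hc hc' le_rfl x y i⟩
  · rw [SignedWord.valuation_horizontalClass, SignedWord.inversionValuation_eq]
  · exact (le_total (valuation n x) (valuation n y)).imp SignedWord.reaches_iff.2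
      SignedWord.reaches_iff.2
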